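/- Let $E=\mathbf{Q}(\sqrt{-D})$ be an imaginary quadratic field of discriminant $-D$, put $\delta=\sqrt{-D}$, let $p$ be a prime, and let $E_p=E\otimes\mathbf{Q}_p$. Let $J=\begin{pmatrix}&&\delta^{-1}\\&1&\\-\delta^{-1}&&\end{pmatrix}$ and let $G$ be the group of $g\in \mathrm{GL}_3(E_p)$ with ${}^t\bar g Jg=\mu(g)J$ for some $\mu(g)\in\mathbf{Q}_p^\times$. Let $H=\{(g_1,\lambda)\in \mathrm{GL}_2(\mathbf{Q}_p)\times E_p^\times:\det g_1=\mathrm{Nm}\,\lambda\}$, embedded in $G$ by $\left(\begin{pmatrix}a&b\\c&d\end{pmatrix},\lambda\right)\mapsto\begin{pmatrix}a&&b\\&\lambda&\\c&&d\end{pmatrix}$, let $Z=\{(t\mathbf 1_2,t):t\in\mathbf{Q}_p^\times\}\subseteq H$, let $U_2\subseteq H$ be the group of $\left(\begin{pmatrix}1&x\\&1\end{pmatrix},1\right)$, and let $U_B\subseteq G$ be the group of upper-triangular unipotent elements. Let $\psi:\mathbf{Q}_p\to\mathbf{C}^\times$ be a nontrivial unitary continuous additive character. Let $(\pi_p,V)$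 be a smooth complex representation of $G$ on which $Z\cong\mathbf{Q}_p^\times$ acts by a character $\omega$, and let $\Lambda:V\to\mathbf{C}$ be a nonzero Whittaker functional, i.e. $\Lambda(\pi_p(u)\varphi)=\psi(\mathrm{tr}_{E_p/\mathbf{Q}_p}(\delta^{-1}u_{23}))\Lambda(\varphi)$ for $u\in U_B$, $\varphi\in V$. Put $W_\varphi(g)=\Lambda(\pi_p(g)\varphi)$. Let $\nu_1:\mathbf{Q}_p^\times\to\mathbf{C}^\times$ be a continuous character with $\nu_1^2\omega=1$. Fix a nonzero right $H$-invariant Radon measure $dg$ on $U_2\backslash H$. For $\varphi\in V$ and a Schwartz--Bruhat function $\Phi$ on the space $\mathbf{Q}_p^2$ of row vectors, consider $$I(\Phi,W_\varphi,\nu,s)=\int_{U_2\backslash H}\nu_1(\det g_1)\,|\det g_1|^s\,\Phi((0,1)g_1)\,W_\varphi(g)\,dg.$$ For $s_0,c\in\mathbf{C}$, we say that $I(\Phi,W_\varphi,\nu,s)|_{s=s_0}$ is finite and equal to $c$ if the integral converges absolutely for $\mathrm{Re}(s)\gg0$ and has a meromorphic continuation to $\mathbf{C}$ which is holomorphic at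 $s_0$ with value $c$ there. Let $\widehat\Phi(\upsilon)=\int_{\mathbf{Q}_p^2}\psi(\xi_1\upsilon_2-\xi_2\upsilon_1)\Phi(\xi)\,d\xi$. (1) If $I(\Phi,W_\varphi,\nu,s)|_{s=0}$ is finite and equal to $0$ for every $\varphi\in V$ and every Schwartz--Bruhat $\Phi$ with $\Phi(0)=0$, then $\pi_p$ is $(H,\nu_1^{-1})$-distinguished: there is a nonzero linear functional $\ell:V\to\mathbf{C}$ with $\ell(\pi_p(h)\varphi)=\nu_1(\mu(h))^{-1}\ell(\varphi)$ for all $h\in H$, $\varphi\in V$. (2) If $I(\Phi,W_\varphi,\nu,s)|_{s=1}$ is finite and equal to $0$ for every $\varphi\in V$ and every Schwartz--Bruhat $\Phi$ with $\widehat\Phi(0)=0$, then $\pi_p$ is $(H,\nu_1^{-1})$-distinguished. -/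

import Mathlib

open MeasureTheory

namespace PicardLocal

/-- `d` is a fundamental discriminant: either `d ≡ 1 (mod 4)` is squarefree, or `d = 4 m` with `m`
squarefree and `m ≡ 2, 3 (mod 4)`. -/
def IsFundamentalDiscriminant (d : ℤ) : Prop :=
  (d % 4 = 1 ∧ Squarefree d) ∨ ∃ m : ℤ, d = 4 * m ∧ (m % 4 = 2 ∨ m % 4 = 3) ∧ Squarefree m

/-- The topology of a quadratic algebra `R ⊕ R ω` over a topological ring `R`. -/
instance instTopologicalSpaceQuadraticAlgebra {R : Type*} [TopologicalSpace R] (a b : R) :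
    TopologicalSpace (QuadraticAlgebra R a b) :=
  TopologicalSpace.induced (QuadraticAlgebra.equivProd a b) inferInstance

noncomputable instance instMeasurableSpacePadic (p : ℕ) [Fact p.Prime] : MeasurableSpace ℚ_[p] := borel _

instance instBorelSpacePadic (p : ℕ) [Fact p.Prime] : BorelSpace ℚ_[p] := ⟨rfl⟩

section Groups

variable (p : ℕ) [Fact p.Prime] (D : ℕ)

/-- `E_p = E ⊗ ℚ_p` for `E = ℚ(√-D)`, written as `ℚ_p ⊕ ℚ_p δ` with `δ² = -D`.  (It is a field or
`ℚ_p × ℚ_p` according to whether `p` is nonsplit or split in `E`.)  The conjugation of `E` is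
`star`, and the norm and trace down to `ℚ_p` are `QuadraticAlgebra.norm` and
`QuadraticAlgebra.trace`. -/
abbrev Ep : Type := QuadraticAlgebra ℚ_[p] (-(D : ℚ_[p])) 0

/-- The element `δ = √-D` of `E_p`. -/
noncomputable def delta : Ep p D := ⟨0, 1⟩

/-- The element `δ⁻¹ = -δ / D` of `E_p`. -/
noncomputable def deltaInv : Ep p D := ⟨0, -(D : ℚ_[p])⁻¹⟩

theorem delta_mul_deltaInv (hD : D ≠ 0) : delta p D * deltaInv p D = 1 := by
  have : (D : ℚ_[p]) ≠ 0 := by exact_mod_cast hD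
  apply QuadraticAlgebra.ext
  · change 0 * 0 + -(D : ℚ_[p]) * 1 * -(D : ℚ_[p])⁻¹ = 1
    field_simp
    simp
  · change 0 * -(D : ℚ_[p])⁻¹ + 1 * 0 + 0 * 1 * -(D : ℚ_[p])⁻¹ = 0
    simp

/-- The matrix `J` of the Hermitian form. -/
noncomputable def J : Matrix (Fin 3) (Fin 3) (Ep p D) :=
  !![0, 0, deltaInv p D; 0, 1, 0; -deltaInv p D, 0, 0]

theorem isSimilitude_mul {S R : Type*} [CommRing S] [CommRing R] [StarRing R] [Algebra S R]
    {A B K : Matrix (Fin 3) (Fin 3) R} {c d : S} (hA : A.conjTranspose * K * A = c • K)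
    (hB : B.conjTranspose * K * B = d • K) :
    (A * B).conjTranspose * K * (A * B) = (c * d) • K := by
  calc _ = B.conjTranspose * (A.conjTranspose * K * A) * B := by
        simp only [Matrix.conjTranspose_mul, Matrix.mul_assoc]
    _ = _ := by rw [hA, Matrix.mul_smul, Matrix.smul_mul, hB, smul_smul]

theorem isSimilitude_inv {S R : Type*} [CommRing S] [CommRing R] [StarRing R] [Algebra S R]
    {A B K : Matrix (Fin 3) (Fin 3) R} {c d : S} (hAB : A * B = 1) (hdc : d * c = 1)
    (hA : A.conjTranspose * K * A = c • K) : B.conjTranspose * K * B = d • K := by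
  have hBA : B.conjTranspose * A.conjTranspose = 1 := by
    rw [← Matrix.conjTranspose_mul, hAB, Matrix.conjTranspose_one]
  have hK : K = d • (A.conjTranspose * K * A) := by rw [hA, smul_smul, hdc, one_smul]
  calc _ = d • ((B.conjTranspose * A.conjTranspose) * K * (A * B)) := by
        conv_lhs => rw [hK]
        simp only [Matrix.mul_smul, Matrix.smul_mul, Matrix.mul_assoc]
    _ = _ := by rw [hAB, hBA, one_mul, mul_one]

/-- The group `G(ℚ_p) = GU(J)(ℚ_p)` of pairs `(g, μ)`, where `g ∈ GL₃(E_p)` and `μ ∈ ℚ_pˣ` satisfy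
`g^* J g = μ J`.  (Since `J ≠ 0`, the similitude `μ = μ(g)` is determined by `g`, so that this is
the group of the matrices `g` for which such a `μ` exists.) -/
noncomputable def G : Subgroup (GL (Fin 3) (Ep p D) × ℚ_[p]ˣ) where
  carrier := {x | (x.1 : Matrix (Fin 3) (Fin 3) (Ep p D)).conjTranspose * J p D *
    (x.1 : Matrix (Fin 3) (Fin 3) (Ep p D)) = (x.2 : ℚ_[p]) • J p D}
  one_mem' := by
    change (1 : Matrix (Fin 3) (Fin 3) (Ep p D)).conjTranspose * J p D * 1 = (1 : ℚ_[p]) • J p D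
    rw [Matrix.conjTranspose_one, one_mul, mul_one, one_smul]
  mul_mem' := fun {x y} hx hy => isSimilitude_mul hx hy
  inv_mem' := fun {x} hx => isSimilitude_inv (Units.mul_inv x.1) (Units.inv_mul x.2) hx

/-- The underlying `3 × 3` matrix of an element of `G(ℚ_p)`. -/
def matG {p : ℕ} [Fact p.Prime] {D : ℕ} (g : G p D) : Matrix (Fin 3) (Fin 3) (Ep p D) :=
  (g.1.1 : Matrix (Fin 3) (Fin 3) (Ep p D))

/-- The similitude character `μ : G(ℚ_p) → ℚ_pˣ`. -/
noncomputable def similitude : G p D →* ℚ_[p]ˣ :=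
  (MonoidHom.snd (GL (Fin 3) (Ep p D)) ℚ_[p]ˣ).comp (G p D).subtype

/-- The group `H(ℚ_p)` of pairs `(g, λ) ∈ GL₂(ℚ_p) × E_pˣ` with `det g = Nm λ`. -/
noncomputable def H : Subgroup (GL (Fin 2) ℚ_[p] × (Ep p D)ˣ) :=
  (Matrix.GeneralLinearGroup.det.comp (MonoidHom.fst (GL (Fin 2) ℚ_[p]) (Ep p D)ˣ)).eqLocus
    ((Units.map QuadraticAlgebra.norm).comp (MonoidHom.snd (GL (Fin 2) ℚ_[p]) (Ep p D)ˣ))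

/-- The projection `h ↦ h₁` from `H(ℚ_p)` to `GL₂(ℚ_p)`. -/
noncomputable def H.proj : H p D →* GL (Fin 2) ℚ_[p] :=
  (MonoidHom.fst (GL (Fin 2) ℚ_[p]) (Ep p D)ˣ).comp (H p D).subtype

/-- The multiplicative map `((a b; c d), λ) ↦ (a 0 b; 0 λ 0; c 0 d)`. -/
noncomputable def blockHom :
    Matrix (Fin 2) (Fin 2) ℚ_[p] × Ep p D →* Matrix (Fin 3) (Fin 3) (Ep p D) where
  toFun x := !![algebraMap ℚ_[p] (Ep p D) (x.1 0 0), 0, algebraMap ℚ_[p] (Ep p D) (x.1 0 1);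
    0, x.2, 0;
    algebraMap ℚ_[p] (Ep p D) (x.1 1 0), 0, algebraMap ℚ_[p] (Ep p D) (x.1 1 1)]
  map_one' := by
    refine Matrix.ext fun i j => ?_
    fin_cases i <;> fin_cases j <;> simp
  map_mul' x y := by
    refine Matrix.ext fun i j => ?_
    fin_cases i <;> fin_cases j <;> simp [Matrix.mul_apply, Fin.sum_univ_succ]

theorem star_algebraMap (x : ℚ_[p]) :
    star (algebraMap ℚ_[p] (Ep p D) x) = algebraMap ℚ_[p] (Ep p D) x := by
  ext <;> simp

theorem blockHom_mem (h : H p D) :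
    (blockHom p D (h.1.1, h.1.2)).conjTranspose * J p D * blockHom p D (h.1.1, h.1.2) =
      ((Matrix.GeneralLinearGroup.det h.1.1 : ℚ_[p]ˣ) : ℚ_[p]) • J p D := by
  have hdet : Matrix.GeneralLinearGroup.det h.1.1 = Units.map QuadraticAlgebra.norm h.1.2 := h.2
  have hdet' : ((Matrix.GeneralLinearGroup.det h.1.1 : ℚ_[p]ˣ) : ℚ_[p]) =
      QuadraticAlgebra.norm (h.1.2 : Ep p D) := by rw [hdet]; rfl
  have hval : ((Matrix.GeneralLinearGroup.det h.1.1 : ℚ_[p]ˣ) : ℚ_[p]) =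
      h.1.1 0 0 * h.1.1 1 1 - h.1.1 0 1 * h.1.1 1 0 := by
    rw [Matrix.GeneralLinearGroup.val_det_apply, Matrix.det_fin_two]
  have hN := QuadraticAlgebra.algebraMap_norm_eq_mul_star (h.1.2 : Ep p D)
  rw [← hdet'] at hN
  generalize ((Matrix.GeneralLinearGroup.det h.1.1 : ℚ_[p]ˣ) : ℚ_[p]) = d at hval hN
  generalize (h.1.1 : Matrix (Fin 2) (Fin 2) ℚ_[p]) = A at *
  generalize (h.1.2 : Ep p D) = z at *
  have hA : algebraMap ℚ_[p] (Ep p D) d = algebraMap ℚ_[p] (Ep p D) (A 0 0) *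
      algebraMap ℚ_[p] (Ep p D) (A 1 1) - algebraMap ℚ_[p] (Ep p D) (A 0 1) *
      algebraMap ℚ_[p] (Ep p D) (A 1 0) := by rw [hval, map_sub, map_mul, map_mul]
  refine Matrix.ext fun i j => ?_
  rw [Matrix.smul_apply, Algebra.smul_def]
  fin_cases i <;> fin_cases j <;>
    simp [Matrix.mul_apply, Fin.sum_univ_succ, blockHom, J, Matrix.conjTranspose_apply,
      star_algebraMap]
  · ring
  · rw [hA]; ring
  · rw [hN]; ring
  · rw [hA]; ring
  · ring

/-- The embedding `H(ℚ_p) → G(ℚ_p)`, `((a b; c d), λ) ↦ (a 0 b; 0 λ 0; c 0 d)`, whose similitude is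
`det (a b; c d) = Nm λ`. -/
noncomputable def embed : H p D →* G p D :=
  MonoidHom.codRestrict
    (((Units.map (blockHom p D)).comp (MulEquiv.prodUnits.symm.toMonoidHom.comp
      (H p D).subtype)).prod (Matrix.GeneralLinearGroup.det.comp (H.proj p D)))
    (G p D) (fun h => blockHom_mem p D h)

/-- The subgroup `Z(ℚ_p) = {(t 1₂, t)}` of `H(ℚ_p)`, the intersection of the centers of `G` and
`H`. -/
noncomputable def centerZ : ℚ_[p]ˣ →* H p D :=
  MonoidHom.codRestrict
    ((Units.map (Matrix.scalar (Fin 2) : ℚ_[p] →+* Matrix (Fin 2) (Fin 2) ℚ_[p]).toMonoidHom).prod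
      (Units.map (algebraMap ℚ_[p] (Ep p D)).toMonoidHom))
    (H p D) (fun t => by
      change _ = _
      ext
      simp [Matrix.GeneralLinearGroup.val_det_apply, pow_two])

/-- The upper-triangular unipotent subgroup `U₂(ℚ_p)` of `H(ℚ_p)`. -/
def U2 : Subgroup (H p D) where
  carrier := {u | u.1.2 = 1 ∧ u.1.1 0 0 = 1 ∧ u.1.1 1 0 = 0 ∧ u.1.1 1 1 = 1}
  one_mem' := by simp
  mul_mem' := by
    rintro x y ⟨hx, h1, h2, h3⟩ ⟨hy, h4, h5, h6⟩
    simp [hx, hy, h1, h2, h3, h4, h5, h6, Matrix.mul_apply]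
  inv_mem' := by
    rintro x ⟨hx, h1, h2, h3⟩
    simp [hx, h1, h2, h3, Matrix.inv_def, Matrix.det_fin_two, Matrix.adjugate_fin_two]

/-- The quotient `U₂(ℚ_p) \ H(ℚ_p)`. -/
def U2H : Type := Quotient (QuotientGroup.rightRel (U2 p D))

noncomputable instance : TopologicalSpace (U2H p D) :=
  inferInstanceAs (TopologicalSpace (Quotient (QuotientGroup.rightRel (U2 p D))))

noncomputable instance : MeasurableSpace (U2H p D) := borel _

instance : BorelSpace (U2H p D) := ⟨rfl⟩

/-- Right translation by `h` on `U₂ \ H`. -/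
noncomputable def U2H.translate {p : ℕ} [Fact p.Prime] {D : ℕ} (h : H p D) : U2H p D → U2H p D :=
  Quotient.map (fun x => x * h) (by
    intro x y hxy
    have hxy' : QuotientGroup.rightRel (U2 p D) x y := hxy
    rw [QuotientGroup.rightRel_apply] at hxy'
    change QuotientGroup.rightRel (U2 p D) (x * h) (y * h)
    rw [QuotientGroup.rightRel_apply]
    simpa [mul_assoc] using hxy')

/-- `m` is an invariant measure on `U₂ \ H`: a nonzero Radon measure that is invariant under right
translation by `H`.  It is unique up to a positive scalar. -/
structure IsInvariantMeasure {p : ℕ} [Fact p.Prime] {D : ℕ} (m : Measure (U2H p D)) : Prop where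
  regular : m.Regular
  ne_zero : m ≠ 0
  map_translate : ∀ h : H p D, m.map (U2H.translate h) = m

/-- Membership of `u ∈ G(ℚ_p)` in the unipotent radical `U_B(ℚ_p)` of the upper-triangular Borel. -/
def IsUpperUnipotent {p : ℕ} [Fact p.Prime] {D : ℕ} (u : G p D) : Prop :=
  (∀ i, matG u i i = 1) ∧ ∀ i j, j < i → matG u i j = 0

end Groups

section Representations

variable {p : ℕ} [Fact p.Prime] {D : ℕ} {V : Type*} [AddCommGroup V] [Module ℂ V]

/-- A representation of `G(ℚ_p)` is smooth if every vector has an open stabilizer. -/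
def IsSmooth (π : Representation ℂ (G p D) V) : Prop :=
  ∀ v : V, IsOpen {g : G p D | π g v = v}

/-- `Λ` is a (nonzero) Whittaker functional for the character `χ(u) = ψ(tr(δ⁻¹ u₂₃))` of
`U_B(ℚ_p)`. -/
structure IsWhittakerFunctional (ψ : AddChar ℚ_[p] Circle) (π : Representation ℂ (G p D) V)
    (Λ : V →ₗ[ℂ] ℂ) : Prop where
  ne_zero : Λ ≠ 0
  equivariant : ∀ u : G p D, IsUpperUnipotent u → ∀ v : V,
    Λ (π u v) = (ψ (QuadraticAlgebra.trace (deltaInv p D * matG u 1 2)) : ℂ) * Λ v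

/-- The representation `π` of `G(ℚ_p)` is `(H, η)`-distinguished. -/
def IsDistinguished (π : Representation ℂ (G p D) V) (η : H p D →* ℂˣ) : Prop :=
  ∃ ℓ : V →ₗ[ℂ] ℂ, ℓ ≠ 0 ∧ ∀ (h : H p D) (v : V), ℓ (π (embed p D h) v) = (η h : ℂ) * ℓ v

/-- The Whittaker function `W_φ(g) = Λ(π(g) φ)`. -/
noncomputable def whittaker (π : Representation ℂ (G p D) V) (Λ : V →ₗ[ℂ] ℂ) (φ : V) (g : G p D) : ℂ :=
  Λ (π g φ)

/-- A character of `ℚ_pˣ`, viewed as a character of `H(ℚ_p)` via the similitude. -/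
noncomputable def viaSimilitude (D : ℕ) (ν : ℚ_[p]ˣ →* ℂˣ) : H p D →* ℂˣ :=
  ν.comp ((similitude p D).comp (embed p D))

end Representations

section SchwartzBruhat

variable {p : ℕ} [Fact p.Prime]

/-- Schwartz-Bruhat functions on `ℚ_p²` (row vectors). -/
structure IsSchwartzBruhat (Φ : (Fin 2 → ℚ_[p]) → ℂ) : Prop where
  locallyConstant : IsLocallyConstant Φ
  compactSupport : HasCompactSupport Φ

/-- The Haar measure on `ℚ_p²` that gives `ℤ_p²` (the unit ball of the sup norm) volume `1`. -/
noncomputable def haarPlane (p : ℕ) [Fact p.Prime] : Measure (Fin 2 → ℚ_[p]) :=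
  Measure.addHaarMeasure
    { carrier := Metric.closedBall 0 1
      isCompact' := isCompact_closedBall 0 1
      interior_nonempty' :=
        ⟨0, Metric.ball_subset_interior_closedBall (Metric.mem_ball_self one_pos)⟩ }

/-- The Fourier transform `Φ̂(υ) = ∫ ψ(⟨ξ, υ⟩) Φ(ξ) dξ` on `ℚ_p²` for the symplectic pairing
`⟨ξ, υ⟩ = ξ₁ υ₂ - ξ₂ υ₁`. -/
noncomputable def fourier (ψ : AddChar ℚ_[p] Circle) (Φ : (Fin 2 → ℚ_[p]) → ℂ)
    (υ : Fin 2 → ℚ_[p]) : ℂ :=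
  ∫ ξ, (ψ (ξ 0 * υ 1 - ξ 1 * υ 0) : ℂ) * Φ ξ ∂(haarPlane p)

end SchwartzBruhat

section LocalIntegral

variable {p : ℕ} [Fact p.Prime] {D : ℕ} {V : Type*} [AddCommGroup V] [Module ℂ V]

/-- The function `g ↦ ν₁(det g₁) |det g₁|^s Φ((0,1) g₁) W(g)` on `H(ℚ_p)`. -/
noncomputable def integrandH (ν₁ : ℚ_[p]ˣ →* ℂˣ) (Φ : (Fin 2 → ℚ_[p]) → ℂ) (W : G p D → ℂ) (s : ℂ)
    (g : H p D) : ℂ :=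
  (ν₁ (Matrix.GeneralLinearGroup.det (H.proj p D g)) : ℂ) *
    ((‖((Matrix.GeneralLinearGroup.det (H.proj p D g) : ℚ_[p]ˣ) : ℚ_[p])‖ : ℝ) : ℂ) ^ s *
    Φ (Matrix.vecMul ![0, 1] (H.proj p D g : Matrix (Fin 2) (Fin 2) ℚ_[p])) * W (embed p D g)

theorem integrandH_left_invariant (ν₁ : ℚ_[p]ˣ →* ℂˣ) (Φ : (Fin 2 → ℚ_[p]) → ℂ)
    {ψ : AddChar ℚ_[p] Circle} {π : Representation ℂ (G p D) V} {Λ : V →ₗ[ℂ] ℂ}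
    (hΛ : IsWhittakerFunctional ψ π Λ) (φ : V) (s : ℂ) (u : H p D) (hu : u ∈ U2 p D) (g : H p D) :
    integrandH ν₁ Φ (whittaker π Λ φ) s (u * g) = integrandH ν₁ Φ (whittaker π Λ φ) s g := by
  obtain ⟨h0, h1, h2, h3⟩ := hu
  have hdet : Matrix.GeneralLinearGroup.det (H.proj p D u) = 1 := by
    ext
    rw [Matrix.GeneralLinearGroup.val_det_apply, Matrix.det_fin_two]
    change u.1.1 0 0 * u.1.1 1 1 - u.1.1 0 1 * u.1.1 1 0 = _
    simp [h1, h2, h3]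
  have hvec : Matrix.vecMul ![0, 1] (H.proj p D u : Matrix (Fin 2) (Fin 2) ℚ_[p]) = ![0, 1] := by
    ext i
    change Matrix.vecMul ![0, 1] (u.1.1 : Matrix (Fin 2) (Fin 2) ℚ_[p]) i = _
    fin_cases i <;> simp [Matrix.vecMul, dotProduct, h2, h3]
  have hmat : matG (embed p D u) = blockHom p D (u.1.1, u.1.2) := rfl
  have hunip : IsUpperUnipotent (embed p D u) := by
    rw [IsUpperUnipotent, hmat]
    constructor
    · intro i
      fin_cases i <;> simp [blockHom, h0, h1, h3]
    · intro i j hij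
      fin_cases i <;> fin_cases j <;> simp [blockHom, h2] at hij ⊢
  have h12 : matG (embed p D u) 1 2 = 0 := by rw [hmat]; simp [blockHom]
  have hW : whittaker π Λ φ (embed p D (u * g)) = whittaker π Λ φ (embed p D g) := by
    simp only [whittaker, map_mul, Module.End.mul_apply]
    rw [hΛ.equivariant _ hunip, h12]
    simp
  rw [integrandH, integrandH, hW, map_mul, map_mul, hdet, one_mul, Units.val_mul,
    ← Matrix.vecMul_vecMul, hvec]

/-- The function `g ↦ ν₁(det g₁) |det g₁|^s Φ((0,1) g₁) W_φ(g)` on `U₂ \ H`. -/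
noncomputable def integrand (ν₁ : ℚ_[p]ˣ →* ℂˣ) (Φ : (Fin 2 → ℚ_[p]) → ℂ)
    {ψ : AddChar ℚ_[p] Circle} {π : Representation ℂ (G p D) V} {Λ : V →ₗ[ℂ] ℂ}
    (hΛ : IsWhittakerFunctional ψ π Λ) (φ : V) (s : ℂ) : U2H p D → ℂ :=
  Quotient.lift (integrandH ν₁ Φ (whittaker π Λ φ) s) (by
    intro x y hxy
    have hxy' : QuotientGroup.rightRel (U2 p D) x y := hxy
    rw [QuotientGroup.rightRel_apply] at hxy'
    have := integrandH_left_invariant ν₁ Φ hΛ φ s _ hxy' x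
    rw [inv_mul_cancel_right] at this
    exact this.symm)

/-- The local integral `I(Φ, W_φ, ν, s) = ∫_{U₂\H} ν₁(det g₁) |det g₁|^s Φ((0,1) g₁) W_φ(g) dg`
(meaningful where the integrand is integrable). -/
noncomputable def localIntegral (m : Measure (U2H p D)) (ν₁ : ℚ_[p]ˣ →* ℂˣ)
    (Φ : (Fin 2 → ℚ_[p]) → ℂ) {ψ : AddChar ℚ_[p] Circle} {π : Representation ℂ (G p D) V}
    {Λ : V →ₗ[ℂ] ℂ} (hΛ : IsWhittakerFunctional ψ π Λ) (φ : V) (s : ℂ) : ℂ :=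
  ∫ x, integrand ν₁ Φ hΛ φ s x ∂m

/-- The value `I(Φ, W_φ, ν, s)|_{s = s₀}` is finite and equal to `c`: the integral converges
absolutely for `Re s ≫ 0`, and it has a meromorphic continuation to `ℂ` that is holomorphic at `s₀`
with value `c` there.  (By the identity theorem there is at most one such `c`.) -/
def LocalIntegralHasValue (m : Measure (U2H p D)) (ν₁ : ℚ_[p]ˣ →* ℂˣ)
    (Φ : (Fin 2 → ℚ_[p]) → ℂ) {ψ : AddChar ℚ_[p] Circle} {π : Representation ℂ (G p D) V}
    {Λ : V →ₗ[ℂ] ℂ} (hΛ : IsWhittakerFunctional ψ π Λ) (φ : V) (s₀ c : ℂ) : Prop :=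
  ∃ σ : ℝ, (∀ s : ℂ, σ < s.re → Integrable (integrand ν₁ Φ hΛ φ s) m) ∧
    ∃ F : ℂ → ℂ, Meromorphic F ∧
      (∀ s : ℂ, σ < s.re → F s = localIntegral m ν₁ Φ hΛ φ s) ∧
      AnalyticAt ℂ F s₀ ∧ F s₀ = c

end LocalIntegral

end PicardLocal

namespace PicardLocal

open Topology Filter

/-! ### Topology of `E_p`, its unit group, and the embedding of `H` in `G`. -/

section TopologyEp

variable (p : ℕ) [Fact p.Prime] (D : ℕ)

/-! Everything rests on one pair of test data. Let Φ₀ be the indicator of a small box around (0, 1),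
so that Φ₀(0) = 0. There is a vector φ₁ for which the integrand is, for every s at once, a fixed
nonzero constant times the indicator of a nonempty open subset of U₂\H (`exists_test_data`).
Convergence for large Re s makes this set of finite measure, and invariance makes the measure
positive, so the integral is a nonzero constant in s, and so is every value of its continuation
(`LocalIntegralHasValue.ne_zero`).

To find φ₁, start from φ₀ with Λ(φ₀) ≠ 0. Conjugating U_B by the torus element of λ scales u₂₃ by λ,
so averaging φ₀ over finitely many unipotents against a character multiplies λ ↦ W(torus λ) by the
indicator of a neighbourhood of 1 (`exists_truncation`), as small as desired since the kernel of ψ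
is bounded. Near 1, W, ν₁ and |det| are constant. Modulo U₂, an element whose bottom row (c, d) lies
in the box is a torus element times a lower triangular one, and the latter fixes φ₁ once the box is
small.

Part (1) follows because its hypothesis contradicts these data: Φ₀(0) = 0, but the value at s = 0 is
not 0.

For part (2) put ℓ(φ) = I(Φ₀, W_φ, ν, s)|_{s=1}. The function Φ₀(· h⁻¹) - |det h| Φ₀ has integral 0,
that is, its Fourier transform vanishes at 0, so the hypothesis applies to it. With h central, ν₁²ω
= 1 turns this into the statement that (bˢ - b) I(Φ₀, W_φ, ν, s), where b = |det h|, continues and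
vanishes at s = 1; since bˢ - b has only a simple zero there, ℓ(φ) is finite
(`exists_hasValue_boxFun`). With h arbitrary, the value for Φ₀(· h⁻¹) is |det h| ℓ(φ), and the
substitution g ↦ gh contributes ν₁(det h)⁻¹ |det h|⁻¹, which gives the equivariance. The test data
give ℓ(φ₁) ≠ 0. -/

theorem continuous_re : Continuous (fun z : Ep p D => z.re) :=
  continuous_fst.comp (continuous_induced_dom (f := QuadraticAlgebra.equivProd _ _))

theorem continuous_im : Continuous (fun z : Ep p D => z.im) :=
  continuous_snd.comp (continuous_induced_dom (f := QuadraticAlgebra.equivProd _ _))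

variable {p D}

theorem continuous_ep {X : Type*} [TopologicalSpace X] {f : X → Ep p D}
    (hre : Continuous fun x => (f x).re) (him : Continuous fun x => (f x).im) : Continuous f :=
  continuous_induced_rng.2 (hre.prodMk him)

theorem continuous_ep_mk {X : Type*} [TopologicalSpace X] {f g : X → ℚ_[p]}
    (hf : Continuous f) (hg : Continuous g) : Continuous fun x => (⟨f x, g x⟩ : Ep p D) :=
  continuous_ep hf hg

instance : ContinuousAdd (Ep p D) where
  continuous_add := by
    have h1 := continuous_re p D
    have h2 := continuous_im p D
    exact continuous_ep (by simp only [QuadraticAlgebra.re_add]; fun_prop)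
      (by simp only [QuadraticAlgebra.im_add]; fun_prop)

instance : ContinuousMul (Ep p D) where
  continuous_mul := by
    have h1 := continuous_re p D
    have h2 := continuous_im p D
    exact continuous_ep (by simp only [QuadraticAlgebra.re_mul]; fun_prop)
      (by simp only [QuadraticAlgebra.im_mul]; fun_prop)

instance : ContinuousNeg (Ep p D) where
  continuous_neg := by
    have h1 := continuous_re p D
    have h2 := continuous_im p D
    exact continuous_ep (by simp only [QuadraticAlgebra.re_neg]; fun_prop)
      (by simp only [QuadraticAlgebra.im_neg]; fun_prop)

theorem continuous_star_ep : Continuous (star : Ep p D → Ep p D) := by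
  have h1 := continuous_re p D
  have h2 := continuous_im p D
  exact continuous_ep (by simp only [QuadraticAlgebra.re_star]; fun_prop)
    (by simp only [QuadraticAlgebra.im_star]; fun_prop)

theorem norm_ep (z : Ep p D) : QuadraticAlgebra.norm z = z.re ^ 2 + D * z.im ^ 2 := by
  rw [QuadraticAlgebra.norm_def]; ring

theorem continuous_norm_ep : Continuous (QuadraticAlgebra.norm : Ep p D → ℚ_[p]) := by
  have h1 := continuous_re p D
  have h2 := continuous_im p D
  have h : Continuous fun z : Ep p D => z.re ^ 2 + D * z.im ^ 2 := by fun_prop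
  exact h.congr fun z => (norm_ep z).symm

theorem continuous_algebraMap_ep : Continuous (algebraMap ℚ_[p] (Ep p D)) :=
  continuous_ep continuous_id continuous_const

theorem norm_unit_ne_zero (z : (Ep p D)ˣ) : QuadraticAlgebra.norm (z : Ep p D) ≠ 0 :=
  (z.isUnit.map QuadraticAlgebra.norm).ne_zero

/-- `E_p` need not be a field, but z⁻¹ = z̄ / N(z) shows that inversion is continuous on its units.
-/
theorem isEmbedding_val_ep : IsEmbedding (Units.val : (Ep p D)ˣ → Ep p D) := by
  refine Units.isEmbedding_val_mk' (f := fun z => star z * algebraMap ℚ_[p] (Ep p D)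
    (QuadraticAlgebra.norm z)⁻¹) ?_ fun u => ?_
  · refine continuous_star_ep.continuousOn.mul (continuous_algebraMap_ep.comp_continuousOn
      (continuous_norm_ep.continuousOn.inv₀ fun z hz => ?_))
    exact (IsUnit.map QuadraticAlgebra.norm hz).ne_zero
  · rw [eq_comm, Units.inv_eq_of_mul_eq_one_right]
    rw [← mul_assoc, ← QuadraticAlgebra.algebraMap_norm_eq_mul_star, ← map_mul,
      mul_inv_cancel₀ (norm_unit_ne_zero u), map_one]

theorem continuous_blockHom : Continuous (blockHom p D) := by
  have h : Continuous fun x : Matrix (Fin 2) (Fin 2) ℚ_[p] × Ep p D =>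
      (blockHom p D x : Matrix (Fin 3) (Fin 3) (Ep p D)) := by
    refine continuous_matrix fun i j => ?_
    have h0 := continuous_algebraMap_ep (p := p) (D := D)
    fin_cases i <;> fin_cases j <;> simp [blockHom] <;> fun_prop
  exact h

theorem continuous_fst_H : Continuous fun h : H p D => h.1.1 :=
  continuous_fst.comp continuous_subtype_val

theorem continuous_snd_H : Continuous fun h : H p D => h.1.2 :=
  continuous_snd.comp continuous_subtype_val

theorem continuous_embed : Continuous (embed p D) := by
  refine Continuous.subtype_mk (Continuous.prodMk (Units.continuous_iff.2 ⟨?_, ?_⟩) ?_) _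
  · exact continuous_blockHom.comp ((Units.continuous_val.comp continuous_fst_H).prodMk
      (Units.continuous_val.comp continuous_snd_H))
  · exact continuous_blockHom.comp ((Units.continuous_coe_inv.comp continuous_fst_H).prodMk
      (Units.continuous_coe_inv.comp continuous_snd_H))
  · refine (Units.isEmbedding_val₀.continuous_iff).2 ?_
    exact (Units.continuous_val.comp continuous_fst_H).matrix_det

end TopologyEp

/-! ### Explicit elements of `H` and of U_B, depending continuously on their parameters. -/

section Sections

variable {p : ℕ} [Fact p.Prime] {D : ℕ}

/-- The element `((N λ, 0; 0, 1), λ)` of `H`. -/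
noncomputable def torus (z : (Ep p D)ˣ) : H p D :=
  ⟨(⟨!![QuadraticAlgebra.norm (z : Ep p D), 0; 0, 1],
      !![QuadraticAlgebra.norm ((z⁻¹ : (Ep p D)ˣ) : Ep p D), 0; 0, 1],
      by simp [Matrix.one_fin_two, norm_unit_ne_zero], by simp [Matrix.one_fin_two, norm_unit_ne_zero]⟩, z), by
    change _ = _
    ext
    simp [Matrix.GeneralLinearGroup.val_det_apply]⟩

/-- The element `((d⁻¹, 0; c, d), 1)` of `H`. -/
noncomputable def lower (c : ℚ_[p]) (d : ℚ_[p]ˣ) : H p D :=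
  ⟨(⟨!![((d⁻¹ : ℚ_[p]ˣ) : ℚ_[p]), 0; c, (d : ℚ_[p])], !![(d : ℚ_[p]), 0; -c, ((d⁻¹ : ℚ_[p]ˣ) : ℚ_[p])],
      by simp [Matrix.one_fin_two, mul_comm], by simp [Matrix.one_fin_two, mul_comm]⟩, 1), by
    change _ = _
    ext
    simp [Matrix.GeneralLinearGroup.val_det_apply]⟩

theorem continuous_torus : Continuous (torus : (Ep p D)ˣ → H p D) := by
  refine Continuous.subtype_mk (Continuous.prodMk (Units.continuous_iff.2 ⟨?_, ?_⟩) continuous_id) _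
  · have : Continuous fun z : (Ep p D)ˣ => QuadraticAlgebra.norm (z : Ep p D) :=
      continuous_norm_ep.comp Units.continuous_val
    refine continuous_matrix fun i j => ?_
    fin_cases i <;> fin_cases j <;> simp <;> fun_prop
  · have : Continuous fun z : (Ep p D)ˣ => QuadraticAlgebra.norm ((z⁻¹ : (Ep p D)ˣ) : Ep p D) :=
      continuous_norm_ep.comp Units.continuous_coe_inv
    refine continuous_matrix fun i j => ?_
    fin_cases i <;> fin_cases j <;> simp only [Units.inv_mk] <;> first | exact this | exact continuous_const

theorem continuous_lower : Continuous fun x : ℚ_[p] × ℚ_[p]ˣ => (lower x.1 x.2 : H p D) := by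
  have h1 : Continuous fun x : ℚ_[p] × ℚ_[p]ˣ => (x.2 : ℚ_[p]) :=
    Units.continuous_val.comp continuous_snd
  have h2 : Continuous fun x : ℚ_[p] × ℚ_[p]ˣ => ((x.2⁻¹ : ℚ_[p]ˣ) : ℚ_[p]) :=
    Units.continuous_coe_inv.comp continuous_snd
  refine Continuous.subtype_mk (Continuous.prodMk (Units.continuous_iff.2 ⟨?_, ?_⟩)
    continuous_const) _
  · refine continuous_matrix fun i j => ?_
    fin_cases i <;> fin_cases j
    exacts [h2, continuous_const, continuous_fst, h1]
  · refine continuous_matrix fun i j => ?_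
    fin_cases i <;> fin_cases j
    exacts [h1, continuous_const, continuous_fst.neg, h2]

theorem torus_one : (torus 1 : H p D) = 1 := by
  refine Subtype.ext (Prod.ext (Units.ext ?_) rfl)
  simp [torus, Matrix.one_fin_two]

theorem lower_one : (lower 0 1 : H p D) = 1 := by
  refine Subtype.ext (Prod.ext (Units.ext ?_) rfl)
  simp [lower, Matrix.one_fin_two]

/-- The entry `u₁₃` of the unipotent element with `u₂₃ = c`. -/
noncomputable def corner (c : Ep p D) : Ep p D := ⟨0, QuadraticAlgebra.norm c / 2⟩

/-- The element `(1, c̄ δ, δ N(c) / 2; 0, 1, c; 0, 0, 1)` of `U_B`. -/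
noncomputable def unip (hD : D ≠ 0) (c : Ep p D) : G p D :=
  ⟨(⟨!![1, star c * delta p D, corner c; 0, 1, c; 0, 0, 1],
      !![1, -(star c * delta p D), star c * delta p D * c - corner c; 0, 1, -c; 0, 0, 1],
      by
        refine Matrix.ext fun i j => ?_
        fin_cases i <;> fin_cases j <;> simp [Matrix.mul_apply, Fin.sum_univ_succ],
      by
        refine Matrix.ext fun i j => ?_
        fin_cases i <;> fin_cases j <;> simp [Matrix.mul_apply, Fin.sum_univ_succ]
        ring⟩, 1), by
    have hD' : (D : ℚ_[p]) ≠ 0 := by exact_mod_cast hD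
    change _ = _
    refine Matrix.ext fun i j => ?_
    fin_cases i <;> fin_cases j <;>
      simp [Matrix.mul_apply, Fin.sum_univ_succ, J, Matrix.conjTranspose_apply] <;>
      ext <;> simp [deltaInv, delta, corner, norm_ep] <;> field_simp <;> ring⟩

theorem continuous_unip (hD : D ≠ 0) : Continuous (unip hD : Ep p D → G p D) := by
  have hs := continuous_star_ep (p := p) (D := D)
  have hc : Continuous (corner : Ep p D → Ep p D) :=
    continuous_ep_mk continuous_const (continuous_norm_ep.div_const 2)
  refine Continuous.subtype_mk (Continuous.prodMk (Units.continuous_iff.2 ⟨?_, ?_⟩)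
    continuous_const) _
  · refine continuous_matrix fun i j => ?_
    fin_cases i <;> fin_cases j
    exacts [continuous_const, hs.mul continuous_const, hc, continuous_const, continuous_const,
      continuous_id, continuous_const, continuous_const, continuous_const]
  · refine continuous_matrix fun i j => ?_
    have e : Continuous fun c : Ep p D => star c * delta p D * c - corner c := by
      simp only [sub_eq_add_neg]; fun_prop
    fin_cases i <;> fin_cases j
    exacts [continuous_const, (hs.mul continuous_const).neg, e, continuous_const, continuous_const,
      continuous_neg, continuous_const, continuous_const, continuous_const]

theorem unip_zero (hD : D ≠ 0) : unip hD (0 : Ep p D) = 1 := by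
  refine Subtype.ext (Prod.ext (Units.ext ?_) rfl)
  refine Matrix.ext fun i j => ?_
  have h0 : (corner 0 : Ep p D) = 0 := by simp [corner]; rfl
  fin_cases i <;> fin_cases j <;> simp [unip, h0]

end Sections

/-! ### Scaling of the Haar measure of ℚ_p² under linear maps. -/

section Modulus

variable {p : ℕ} [Fact p.Prime]

instance : (haarPlane p).IsAddHaarMeasure := by unfold haarPlane; infer_instance

/-- Right multiplication by `A` scales the Haar measure of the plane by `|det A|`. -/
def HasModulus (A : Matrix (Fin 2) (Fin 2) ℚ_[p]) : Prop :=
  (haarPlane p).map (fun v => Matrix.vecMul v A) = ENNReal.ofReal ‖A.det‖⁻¹ • haarPlane p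

theorem continuous_vecMul_const (A : Matrix (Fin 2) (Fin 2) ℚ_[p]) :
    Continuous fun v : Fin 2 → ℚ_[p] => Matrix.vecMul v A :=
  continuous_id.matrix_vecMul continuous_const

theorem HasModulus.mul {A B : Matrix (Fin 2) (Fin 2) ℚ_[p]} (hA : HasModulus A)
    (hB : HasModulus B) : HasModulus (A * B) := by
  unfold HasModulus at *
  have h : (fun v => Matrix.vecMul v (A * B)) =
      (fun v => Matrix.vecMul v B) ∘ fun v => Matrix.vecMul v A := by
    funext v; simp [Matrix.vecMul_vecMul]
  rw [h, ← Measure.map_map (continuous_vecMul_const B).measurable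
    (continuous_vecMul_const A).measurable, hA, Measure.map_smul, hB, smul_smul,
    ← ENNReal.ofReal_mul (by positivity), Matrix.det_mul, norm_mul, mul_inv]

theorem HasModulus.of_mul_eq_one {A B : Matrix (Fin 2) (Fin 2) ℚ_[p]} (hA : HasModulus A)
    (hAB : A * B = 1) : HasModulus B := by
  unfold HasModulus at *
  have hdet : A.det * B.det = 1 := by rw [← Matrix.det_mul, hAB, Matrix.det_one]
  have hn : ‖A.det‖ * ‖B.det‖ = 1 := by rw [← norm_mul, hdet, norm_one]
  have hB0 : 0 < ‖B.det‖ := by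
    rw [norm_pos_iff]; exact right_ne_zero_of_mul_eq_one hdet
  have h : (fun v => Matrix.vecMul v B) ∘ (fun v => Matrix.vecMul v A) = id := by
    funext v; simp [Matrix.vecMul_vecMul, hAB]
  have h2 := congrArg (Measure.map fun v => Matrix.vecMul v B) hA
  rw [Measure.map_map (continuous_vecMul_const B).measurable
    (continuous_vecMul_const A).measurable, h, Measure.map_id, Measure.map_smul] at h2
  have h3 := congrArg (fun ν => ENNReal.ofReal ‖B.det‖⁻¹ • ν) h2
  simp only [smul_smul] at h3
  rw [← ENNReal.ofReal_mul (by positivity), ← mul_inv, mul_comm ‖B.det‖, hn, inv_one,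
    ENNReal.ofReal_one, one_smul] at h3
  exact h3.symm

/-- Uniqueness of Haar measure: the pushforward is a multiple of the original, and one set of finite
positive measure determines the multiple. -/
theorem HasModulus.of_set {A : Matrix (Fin 2) (Fin 2) ℚ_[p]} (hA : A.det ≠ 0)
    {L : Set (Fin 2 → ℚ_[p])} (hL : MeasurableSet L) (h0 : haarPlane p L ≠ 0)
    (htop : haarPlane p L ≠ ⊤)
    (h : haarPlane p ((fun v => Matrix.vecMul v A) ⁻¹' L) =
      ENNReal.ofReal ‖A.det‖⁻¹ * haarPlane p L) : HasModulus A := by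
  have hu : IsUnit A.det := isUnit_iff_ne_zero.2 hA
  let e : (Fin 2 → ℚ_[p]) ≃ₜ+ (Fin 2 → ℚ_[p]) :=
    { toFun := fun v => Matrix.vecMul v A
      invFun := fun v => Matrix.vecMul v A⁻¹
      left_inv := fun v => by simp [Matrix.vecMul_vecMul, Matrix.mul_nonsing_inv _ hu]
      right_inv := fun v => by simp [Matrix.vecMul_vecMul, Matrix.nonsing_inv_mul _ hu]
      map_add' := fun v w => Matrix.add_vecMul _ _ _
      continuous_toFun := continuous_vecMul_const A
      continuous_invFun := continuous_vecMul_const A⁻¹ }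
  have : ((haarPlane p).map (fun v => Matrix.vecMul v A)).IsAddHaarMeasure :=
    e.isAddHaarMeasure_map (haarPlane p)
  have hc := Measure.isAddLeftInvariant_eq_smul
    ((haarPlane p).map (fun v => Matrix.vecMul v A)) (haarPlane p)
  set c := Measure.addHaarScalarFactor ((haarPlane p).map (fun v => Matrix.vecMul v A)) (haarPlane p)
  have h1 := congrArg (fun ν => ν L) hc
  simp only [Measure.map_apply (continuous_vecMul_const A).measurable hL, h, Measure.smul_apply,
    ENNReal.smul_def, smul_eq_mul] at h1
  rw [ENNReal.mul_left_inj h0 htop] at h1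
  rw [HasModulus, h1]
  exact hc

theorem norm_sub_le_max (x y : ℚ_[p]) : ‖x - y‖ ≤ max ‖x‖ ‖y‖ := by
  simpa [sub_eq_add_neg] using IsUltrametricDist.norm_add_le_max x (-y)

theorem isOpen_norm_le {X : Type*} [TopologicalSpace X] {f : X → ℚ_[p]} (hf : Continuous f) {r : ℝ}
    (hr : r ≠ 0) : IsOpen {x | ‖f x‖ ≤ r} := by
  have := (IsUltrametricDist.isOpen_closedBall (0 : ℚ_[p]) hr).preimage hf
  simpa [Set.preimage, Metric.mem_closedBall, dist_zero_right] using this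

theorem isOpen_box {r s : ℝ} (hr : r ≠ 0) (hs : s ≠ 0) (i j : Fin 2) :
    IsOpen {v : Fin 2 → ℚ_[p] | ‖v i‖ ≤ r ∧ ‖v j‖ ≤ s} :=
  (isOpen_norm_le (continuous_apply i) hr).inter (isOpen_norm_le (continuous_apply j) hs)

theorem haarPlane_box_ne_zero {r s : ℝ} (hr : 0 < r) (hs : 0 < s) (i j : Fin 2) :
    haarPlane p {v | ‖v i‖ ≤ r ∧ ‖v j‖ ≤ s} ≠ 0 :=
  ((isOpen_box hr.ne' hs.ne' i j).measure_pos _ ⟨0, by simp [hr.le], by simp [hs.le]⟩).ne'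

theorem haarPlane_box_ne_top {r s : ℝ} (i j : Fin 2) (hij : i ≠ j) :
    haarPlane p {v | ‖v i‖ ≤ r ∧ ‖v j‖ ≤ s} ≠ ⊤ := by
  have hsub : {v : Fin 2 → ℚ_[p] | ‖v i‖ ≤ r ∧ ‖v j‖ ≤ s} ⊆ Metric.closedBall 0 (max |r| |s|) := by
    rintro v ⟨h1, h2⟩
    rw [mem_closedBall_zero_iff, pi_norm_le_iff_of_nonneg (by positivity)]
    intro k
    have hk : k = i ∨ k = j := by omega
    rcases hk with rfl | rfl
    · exact (h1.trans (le_abs_self r)).trans (le_max_left _ _)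
    · exact (h2.trans (le_abs_self s)).trans (le_max_right _ _)
  exact ((measure_mono hsub).trans_lt (isCompact_closedBall _ _).measure_lt_top).ne

theorem hasModulus_transvection {i j : Fin 2} (hij : i ≠ j) (c : ℚ_[p]) :
    HasModulus (Matrix.transvection i j c) := by
  have hdet : (Matrix.transvection i j c).det = 1 := Matrix.det_transvection_of_ne i j hij c
  -- A box this thin in coordinate i is stable under the transvection: `v i * c` has norm at most 1,
  -- so by the ultrametric inequality adding it to `v j` stays in the unit ball.
  have hr : (0 : ℝ) < (1 + ‖c‖)⁻¹ := by positivity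
  refine HasModulus.of_set (by rw [hdet]; exact one_ne_zero)
    (isOpen_box hr.ne' one_ne_zero i j).measurableSet (haarPlane_box_ne_zero hr one_pos i j)
    (haarPlane_box_ne_top i j hij) ?_
  have hs : ∀ (v : Fin 2 → ℚ_[p]) (k : Fin 2),
      Matrix.vecMul v (Matrix.single i j c) k = if j = k then v i * c else 0 := by
    intro v k
    simp [Matrix.vecMul, dotProduct, Matrix.single_apply, ite_and, -Fin.sum_univ_two]
  have hi : ∀ v : Fin 2 → ℚ_[p], Matrix.vecMul v (Matrix.transvection i j c) i = v i := by
    intro v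
    simp [Matrix.transvection, Matrix.vecMul_add, hs, hij.symm]
  have hj : ∀ v : Fin 2 → ℚ_[p],
      Matrix.vecMul v (Matrix.transvection i j c) j = v j + v i * c := by
    intro v
    simp [Matrix.transvection, Matrix.vecMul_add, hs]
  rw [hdet, norm_one, inv_one, ENNReal.ofReal_one, one_mul]
  congr 1
  ext v
  simp only [Set.mem_preimage, Set.mem_ofPred_eq, hi, hj]
  refine and_congr_right fun h => ?_
  have hvc : ‖v i * c‖ ≤ 1 := by
    rw [norm_mul]
    calc ‖v i‖ * ‖c‖ ≤ (1 + ‖c‖)⁻¹ * (1 + ‖c‖) := by gcongr; linarith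
      _ = 1 := by field_simp
  constructor
  · intro h2
    have := norm_sub_le_max (v j + v i * c) (v i * c)
    rw [add_sub_cancel_right] at this
    exact this.trans (max_le h2 hvc)
  · intro h2
    exact (IsUltrametricDist.norm_add_le_max _ _).trans (max_le h2 hvc)

/-- The diagonal matrix with entry `a` at `i` and `1` elsewhere. -/
noncomputable def diagAt (i : Fin 2) (a : ℚ_[p]) : Matrix (Fin 2) (Fin 2) ℚ_[p] :=
  Matrix.diagonal (Function.update 1 i a)

theorem diagAt_mul (i : Fin 2) (a b : ℚ_[p]) : diagAt i a * diagAt i b = diagAt i (a * b) := by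
  rw [diagAt, diagAt, diagAt, Matrix.diagonal_mul_diagonal]
  congr 1
  funext k
  by_cases h : k = i
  · subst h; simp
  · simp [h]

theorem diagAt_one (i : Fin 2) : diagAt i (1 : ℚ_[p]) = 1 := by
  rw [diagAt, ← Pi.one_apply (M := fun _ : Fin 2 => ℚ_[p]) i, Function.update_eq_self]
  exact Matrix.diagonal_one

theorem det_diagAt (i : Fin 2) (a : ℚ_[p]) : (diagAt i a).det = a := by
  rw [diagAt, Matrix.det_diagonal, Fin.prod_univ_two]
  fin_cases i <;> simp

theorem vecMul_diagAt_same (i : Fin 2) (a : ℚ_[p]) (v : Fin 2 → ℚ_[p]) :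
    Matrix.vecMul v (diagAt i a) i = v i * a := by
  simp [diagAt, Matrix.vecMul_diagonal]

theorem vecMul_diagAt_of_ne {i j : Fin 2} (hij : i ≠ j) (a : ℚ_[p]) (v : Fin 2 → ℚ_[p]) :
    Matrix.vecMul v (diagAt i a) j = v j := by
  simp [diagAt, Matrix.vecMul_diagonal, hij.symm]

theorem hasModulus_diagAt_unit {i j : Fin 2} (hij : i ≠ j) {a : ℚ_[p]} (ha : ‖a‖ = 1) :
    HasModulus (diagAt i a) := by
  refine HasModulus.of_set (by rw [det_diagAt]; rintro rfl; simp at ha)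
    (isOpen_box one_ne_zero one_ne_zero i j).measurableSet
    (haarPlane_box_ne_zero one_pos one_pos i j) (haarPlane_box_ne_top i j hij) ?_
  rw [det_diagAt, ha, inv_one, ENNReal.ofReal_one, one_mul]
  congr 1
  ext v
  simp [vecMul_diagAt_same, vecMul_diagAt_of_ne hij, ha]

theorem hasModulus_diagAt_prime {i j : Fin 2} (hij : i ≠ j) : HasModulus (diagAt i (p : ℚ_[p])) := by
  have hp : (0 : ℝ) < (p : ℝ)⁻¹ := by
    have := (Fact.out : p.Prime).pos
    positivity
  have hp0 : (p : ℚ_[p]) ≠ 0 := by exact_mod_cast (Fact.out : p.Prime).ne_zero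
  set L : Set (Fin 2 → ℚ_[p]) := {v | ‖v i‖ ≤ (p : ℝ)⁻¹ ∧ ‖v j‖ ≤ 1} with hLdef
  have hL : MeasurableSet L := (isOpen_box hp.ne' one_ne_zero i j).measurableSet
  refine HasModulus.of_set (by rwa [det_diagAt]) hL
    (haarPlane_box_ne_zero hp one_pos i j) (haarPlane_box_ne_top i j hij) ?_
  -- In coordinate i the preimage of pℤ_p is ℤ_p, the disjoint union of the p residue classes mod p.
  -- Hence the measure grows by the factor p = |p|⁻¹.
  have hpre : (fun v => Matrix.vecMul v (diagAt i (p : ℚ_[p]))) ⁻¹' L =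
      ⋃ k ∈ Finset.range p, (fun v => (Pi.single i (-(k : ℚ_[p])) : Fin 2 → ℚ_[p]) + v) ⁻¹' L := by
    ext v
    simp only [hLdef, Set.mem_preimage, Set.mem_ofPred_eq, vecMul_diagAt_same,
      vecMul_diagAt_of_ne hij, Set.mem_iUnion, Pi.add_apply, Pi.single_eq_same,
      Pi.single_eq_of_ne hij.symm, zero_add, norm_mul, Padic.norm_p, exists_prop,
      exists_and_right, ← and_assoc, Finset.mem_range]
    refine and_congr_left fun _ => ?_
    rw [mul_le_iff_le_one_left hp]
    constructor
    · intro h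
      obtain ⟨x, hx⟩ : ∃ x : ℤ_[p], (x : ℚ_[p]) = v i := ⟨⟨v i, h⟩, rfl⟩
      obtain ⟨n, hn, hn'⟩ := PadicInt.exists_mem_range x
      refine ⟨n, hn, ?_⟩
      rw [PadicInt.maximalIdeal_eq_span_p, ← pow_one (p : ℤ_[p]),
        ← PadicInt.norm_le_pow_iff_mem_span_pow] at hn'
      rw [neg_add_eq_sub]
      rw [PadicInt.norm_def, PadicInt.coe_sub, PadicInt.coe_natCast, hx] at hn'
      simpa using hn'
    · rintro ⟨n, hn, hn'⟩
      have h1 : ‖(n : ℚ_[p])‖ ≤ 1 := by exact_mod_cast Padic.norm_int_le_one (n : ℤ)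
      have := IsUltrametricDist.norm_add_le_max (n : ℚ_[p]) (-(n : ℚ_[p]) + v i)
      rw [add_neg_cancel_left] at this
      refine this.trans (max_le h1 (hn'.trans ?_))
      exact inv_le_one_of_one_le₀ (by exact_mod_cast (Fact.out : p.Prime).one_lt.le)
  have hdisj : Set.PairwiseDisjoint (Finset.range p : Set ℕ)
      (fun k : ℕ => (fun v => (Pi.single i (-(k : ℚ_[p])) : Fin 2 → ℚ_[p]) + v) ⁻¹' L) := by
    intro k hk l hl hkl
    refine Set.disjoint_left.2 fun v hv hv' => hkl ?_
    have h1 : ‖-(k : ℚ_[p]) + v i‖ ≤ (p : ℝ)⁻¹ := by simpa using hv.1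
    have h2 : ‖-(l : ℚ_[p]) + v i‖ ≤ (p : ℝ)⁻¹ := by simpa using hv'.1
    have h3 := (norm_sub_le_max (-(k : ℚ_[p]) + v i) (-(l : ℚ_[p]) + v i)).trans
      (max_le h1 h2)
    have h4 : -(k : ℚ_[p]) + v i - (-(l : ℚ_[p]) + v i) = (((l : ℤ) - (k : ℤ) : ℤ) : ℚ_[p]) := by
      push_cast; ring
    rw [h4] at h3
    have h5 := (Padic.norm_int_le_pow_iff_dvd ((l : ℤ) - k) 1).1 (by simpa using h3)
    rw [pow_one] at h5
    have hk' : k < p := by simpa using hk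
    have hl' : l < p := by simpa using hl
    have h6 := Int.eq_zero_of_abs_lt_dvd h5 (by rw [abs_lt]; constructor <;> omega)
    omega
  rw [hpre, measure_biUnion_finset hdisj fun k _ => (measurable_const_add _) hL]
  simp only [measure_preimage_add, Finset.sum_const, Finset.card_range, det_diagAt,
    Padic.norm_p, inv_inv, nsmul_eq_mul, ENNReal.ofReal_natCast]

/-- Write a as a unit times a power of p. -/
theorem hasModulus_diagAt {i j : Fin 2} (hij : i ≠ j) {a : ℚ_[p]} (ha : a ≠ 0) :
    HasModulus (diagAt i a) := by
  have hp0 : (p : ℚ_[p]) ≠ 0 := by exact_mod_cast (Fact.out : p.Prime).ne_zero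
  have hpow : ∀ n : ℕ, HasModulus (diagAt i ((p : ℚ_[p]) ^ n)) := by
    intro n
    induction n with
    | zero => rw [pow_zero]; exact hasModulus_diagAt_unit hij norm_one
    | succ n ih => rw [pow_succ, ← diagAt_mul]; exact ih.mul (hasModulus_diagAt_prime hij)
  have hzpow : ∀ n : ℤ, HasModulus (diagAt i ((p : ℚ_[p]) ^ n)) := by
    intro n
    obtain ⟨n, rfl | rfl⟩ := n.eq_nat_or_neg
    · simpa using hpow n
    · refine (hpow n).of_mul_eq_one ?_
      rw [diagAt_mul, zpow_neg, zpow_natCast, mul_inv_cancel₀ (pow_ne_zero _ hp0), diagAt_one]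
  have h1 : ‖a * (p : ℚ_[p]) ^ (-a.valuation)‖ = 1 := by
    have hpR : (p : ℝ) ≠ 0 := by exact_mod_cast (Fact.out : p.Prime).ne_zero
    rw [norm_mul, Padic.norm_eq_zpow_neg_valuation ha, Padic.norm_p_zpow, neg_neg,
      ← zpow_add₀ hpR, neg_add_cancel, zpow_zero]
  have h2 := (hasModulus_diagAt_unit hij h1).mul (hzpow a.valuation)
  rwa [diagAt_mul, mul_assoc, ← zpow_add₀ hp0, neg_add_cancel, zpow_zero, mul_one] at h2

theorem hasModulus {A : Matrix (Fin 2) (Fin 2) ℚ_[p]} (hA : A.det ≠ 0) : HasModulus A := by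
  refine Matrix.diagonal_transvection_induction_of_det_ne_zero HasModulus A hA ?_ ?_ ?_
  · intro d hd
    rw [Matrix.det_diagonal, Fin.prod_univ_two] at hd
    have h : Matrix.diagonal d = diagAt 0 (d 0) * diagAt 1 (d 1) := by
      rw [diagAt, diagAt, Matrix.diagonal_mul_diagonal]
      congr 1
      funext k
      fin_cases k <;> simp
    rw [h]
    exact (hasModulus_diagAt zero_ne_one (left_ne_zero_of_mul hd)).mul
      (hasModulus_diagAt one_ne_zero (right_ne_zero_of_mul hd))
  · exact fun t => hasModulus_transvection t.hij t.c
  · exact fun A B _ _ hA hB => hA.mul hB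

theorem integral_comp_vecMul {A : Matrix (Fin 2) (Fin 2) ℚ_[p]} (hA : A.det ≠ 0)
    (Φ : (Fin 2 → ℚ_[p]) → ℂ) (hΦ : IsLocallyConstant Φ) :
    ∫ v, Φ (Matrix.vecMul v A) ∂haarPlane p = (‖A.det‖⁻¹ : ℝ) * ∫ v, Φ v ∂haarPlane p := by
  have h := hasModulus hA
  have h2 := integral_map (continuous_vecMul_const A).measurable.aemeasurable
    (hΦ.continuous.aestronglyMeasurable (μ := (haarPlane p).map fun v => Matrix.vecMul v A))
  rw [← h2, h, integral_smul_measure, ENNReal.toReal_ofReal (by positivity), Complex.real_smul]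

end Modulus

/-! ### Identity theorem and removal of a simple zero. -/

section Meromorphic

/-- The order of F is infinite at one point, hence everywhere because ℂ is connected. Analyticity at
s₀ is needed to pass from the punctured neighbourhood to the value itself, which `Meromorphic`
leaves arbitrary. -/
theorem eq_zero_of_meromorphic {F : ℂ → ℂ} (hF : Meromorphic F) {σ : ℝ}
    (h0 : ∀ s : ℂ, σ < s.re → F s = 0) {s₀ : ℂ} (hs : AnalyticAt ℂ F s₀) : F s₀ = 0 := by
  have hopen : IsOpen {s : ℂ | σ < s.re} := isOpen_lt continuous_const Complex.continuous_re
  have h1 : ∃ u : ℂ, meromorphicOrderAt F u = ⊤ := by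
    refine ⟨((σ + 1 : ℝ) : ℂ), meromorphicOrderAt_eq_top_iff.2 ?_⟩
    refine Filter.Eventually.filter_mono nhdsWithin_le_nhds ?_
    filter_upwards [hopen.mem_nhds (x := ((σ + 1 : ℝ) : ℂ)) (by simp)] with s hs using h0 s hs
  have h2 : meromorphicOrderAt F s₀ = ⊤ := by
    by_contra h
    obtain ⟨u, hu⟩ := h1
    exact hF.exists_meromorphicOrderAt_ne_top_iff_forall.1 ⟨s₀, h⟩ u hu
  rw [meromorphicOrderAt_eq_top_iff] at h2
  have h3 : Tendsto F (𝓝[≠] s₀) (𝓝 0) := tendsto_const_nhds.congr' (h2.mono fun _ h => h.symm)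
  exact tendsto_nhds_unique (hs.continuousAt.tendsto.mono_left nhdsWithin_le_nhds) h3

theorem Meromorphic.dslope {F : ℂ → ℂ} (hF : Meromorphic F) (a : ℂ) :
    Meromorphic (dslope F a) := by
  intro x
  have h1 : MeromorphicAt (fun z => (z - a)⁻¹ • (F z - F a)) x :=
    (((MeromorphicAt.id x).sub (MeromorphicAt.const a x)).inv).smul
      ((hF x).sub (MeromorphicAt.const (F a) x))
  refine h1.congr ?_
  have h2 : ∀ᶠ z in 𝓝[≠] x, z ≠ a := by
    by_cases hx : x = a
    · subst hx; exact eventually_mem_nhdsWithin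
    · exact Filter.Eventually.filter_mono nhdsWithin_le_nhds (isOpen_ne.mem_nhds hx)
  filter_upwards [h2] with z hz
  rw [dslope_of_ne _ hz, slope_def_module]

theorem AnalyticAt.dslope {F : ℂ → ℂ} {a : ℂ} (hF : AnalyticAt ℂ F a) :
    AnalyticAt ℂ (dslope F a) a := by
  obtain ⟨q, hq⟩ := hF
  exact hq.has_fpower_series_dslope_fslope.analyticAt

/-- If `F` vanishes at `a` and `G` has a simple zero there, then `F / G` extends holomorphically
over `a`. -/
theorem exists_meromorphic_div {F G : ℂ → ℂ} (hF : Meromorphic F) (hG : Meromorphic G) {a : ℂ}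
    (hFa : AnalyticAt ℂ F a) (hGa : AnalyticAt ℂ G a) (hF0 : F a = 0) (hG0 : G a = 0)
    (hG' : deriv G a ≠ 0) :
    ∃ Q : ℂ → ℂ, Meromorphic Q ∧ AnalyticAt ℂ Q a ∧ ∀ s ≠ a, Q s = F s / G s := by
  refine ⟨fun s => dslope F a s / dslope G a s, fun x => ?_, ?_, fun s hs => ?_⟩
  · exact (Meromorphic.dslope hF a x).div (Meromorphic.dslope hG a x)
  · exact (AnalyticAt.dslope hFa).div (AnalyticAt.dslope hGa) (by rwa [dslope_same])
  · beta_reduce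
    rw [dslope_of_ne _ hs, dslope_of_ne _ hs, slope_def_field, slope_def_field, hF0, hG0, sub_zero,
      sub_zero, div_div_div_cancel_right₀ (sub_ne_zero.2 hs)]

end Meromorphic

/-! ### The space U₂\H and its invariant measure. -/

section Quotient

variable {p : ℕ} [Fact p.Prime] {D : ℕ}

/-- The coset of `h` in `U₂ \ H`. -/
noncomputable def U2H.mk (h : H p D) : U2H p D := Quotient.mk (QuotientGroup.rightRel (U2 p D)) h

theorem U2H.mk_surjective : Function.Surjective (U2H.mk : H p D → U2H p D) := Quotient.mk_surjective

theorem U2H.isQuotientMap_mk : IsQuotientMap (U2H.mk : H p D → U2H p D) := isQuotientMap_quot_mk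

theorem U2H.translate_mk (h g : H p D) : U2H.translate h (U2H.mk g) = U2H.mk (g * h) := rfl

theorem U2H.translate_translate (h k : H p D) (x : U2H p D) :
    U2H.translate h (U2H.translate k x) = U2H.translate (k * h) x := by
  obtain ⟨g, rfl⟩ := U2H.mk_surjective x
  simp [U2H.translate_mk, mul_assoc]

theorem U2H.translate_one (x : U2H p D) : U2H.translate 1 x = x := by
  obtain ⟨g, rfl⟩ := U2H.mk_surjective x
  simp [U2H.translate_mk]

theorem U2H.continuous_translate (h : H p D) : Continuous (U2H.translate h : U2H p D → U2H p D) := by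
  rw [U2H.isQuotientMap_mk.continuous_iff]
  exact U2H.isQuotientMap_mk.continuous.comp (continuous_mul_const h)

/-- Right translation by `h` as a homeomorphism of `U₂ \ H`. -/
noncomputable def U2H.translateHomeo (h : H p D) : U2H p D ≃ₜ U2H p D where
  toFun := U2H.translate h
  invFun := U2H.translate h⁻¹
  left_inv x := by rw [U2H.translate_translate, mul_inv_cancel, U2H.translate_one]
  right_inv x := by rw [U2H.translate_translate, inv_mul_cancel, U2H.translate_one]
  continuous_toFun := U2H.continuous_translate h
  continuous_invFun := U2H.continuous_translate h⁻¹

theorem U2H.measurableEmbedding_translate (h : H p D) :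
    MeasurableEmbedding (U2H.translate h : U2H p D → U2H p D) :=
  (U2H.translateHomeo h).measurableEmbedding

theorem IsInvariantMeasure.measurePreserving {m : Measure (U2H p D)} (hm : IsInvariantMeasure m)
    (h : H p D) : MeasurePreserving (U2H.translate h) m m :=
  ⟨(U2H.continuous_translate h).measurable, hm.map_translate h⟩

/-- The translates of S cover the space. If S were null, every compact set would be null, and inner
regularity would give m = 0. -/
theorem IsInvariantMeasure.measure_ne_zero {m : Measure (U2H p D)} (hm : IsInvariantMeasure m)
    {S : Set (U2H p D)} (hS : IsOpen S) (hne : S.Nonempty) : m S ≠ 0 := by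
  intro h0
  have := hm.regular
  obtain ⟨y, hy⟩ := hne
  obtain ⟨k, rfl⟩ := U2H.mk_surjective y
  have hK : ∀ K : Set (U2H p D), IsCompact K → m K = 0 := by
    intro K hK
    refine hK.measure_zero_of_nhdsWithin fun x _ => ?_
    obtain ⟨g, rfl⟩ := U2H.mk_surjective x
    refine ⟨U2H.translate (g⁻¹ * k) ⁻¹' S, mem_nhdsWithin_of_mem_nhds
      ((hS.preimage (U2H.continuous_translate _)).mem_nhds ?_), ?_⟩
    · change U2H.translate (g⁻¹ * k) (U2H.mk g) ∈ S
      rw [U2H.translate_mk, mul_inv_cancel_left]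
      exact hy
    · rw [(hm.measurePreserving _).measure_preimage hS.measurableSet.nullMeasurableSet, h0]
  refine hm.ne_zero (Measure.measure_univ_eq_zero.1 ?_)
  rw [isOpen_univ.measure_eq_iSup_isCompact]
  simp only [ENNReal.iSup_eq_zero]
  exact fun K _ hKc => hK K hKc

/-- The determinant of the `GL₂`-component. -/
noncomputable def detH (h : H p D) : ℚ_[p]ˣ := Matrix.GeneralLinearGroup.det (H.proj p D h)

theorem detH_mul (g h : H p D) : detH (g * h) = detH g * detH h := by simp [detH]

theorem detH_eq_norm (h : H p D) : (detH h : ℚ_[p]) = QuadraticAlgebra.norm (h.1.2 : Ep p D) :=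
  congrArg Units.val h.2

theorem viaSimilitude_apply (ν : ℚ_[p]ˣ →* ℂˣ) (h : H p D) : viaSimilitude D ν h = ν (detH h) := rfl

theorem continuous_detH : Continuous (detH : H p D → ℚ_[p]ˣ) :=
  Units.isEmbedding_val₀.continuous_iff.2 (Units.continuous_val.comp continuous_fst_H).matrix_det

/-- The `GL₂`-component as a matrix. -/
noncomputable def matH (h : H p D) : Matrix (Fin 2) (Fin 2) ℚ_[p] := h.1.1

theorem matH_mul (g h : H p D) : matH (g * h) = matH g * matH h := rfl

theorem matH_one : matH (1 : H p D) = 1 := rfl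

theorem det_matH (h : H p D) : (matH h).det = detH h := rfl

theorem det_matH_ne_zero (h : H p D) : (matH h).det ≠ 0 := by
  rw [det_matH]; exact Units.ne_zero _

theorem matH_mul_matH_inv (h : H p D) : matH h * matH h⁻¹ = 1 := by
  rw [← matH_mul, mul_inv_cancel, matH_one]

end Quotient

/-! ### Operations on Schwartz–Bruhat functions. -/

section SchwartzClosure

variable {p : ℕ} [Fact p.Prime] {D : ℕ}

theorem IsSchwartzBruhat.add {Φ Ψ : (Fin 2 → ℚ_[p]) → ℂ} (hΦ : IsSchwartzBruhat Φ)
    (hΨ : IsSchwartzBruhat Ψ) : IsSchwartzBruhat fun v => Φ v + Ψ v :=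
  ⟨hΦ.1.add hΨ.1, hΦ.2.add hΨ.2⟩

theorem IsSchwartzBruhat.const_mul {Φ : (Fin 2 → ℚ_[p]) → ℂ} (hΦ : IsSchwartzBruhat Φ) (a : ℂ) :
    IsSchwartzBruhat fun v => a * Φ v :=
  ⟨hΦ.1.comp (a * ·), hΦ.2.mul_left⟩

theorem IsSchwartzBruhat.translate {Φ : (Fin 2 → ℚ_[p]) → ℂ} (hΦ : IsSchwartzBruhat Φ)
    (h : H p D) : IsSchwartzBruhat fun v => Φ (Matrix.vecMul v (matH h⁻¹)) := by
  refine ⟨hΦ.1.comp_continuous (continuous_vecMul_const _), ?_⟩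
  let e : (Fin 2 → ℚ_[p]) ≃ₜ (Fin 2 → ℚ_[p]) :=
    { toFun := fun v => Matrix.vecMul v (matH h⁻¹)
      invFun := fun v => Matrix.vecMul v (matH h)
      left_inv := fun v => by
        beta_reduce
        rw [Matrix.vecMul_vecMul, ← matH_mul, inv_mul_cancel, matH_one, Matrix.vecMul_one]
      right_inv := fun v => by
        beta_reduce
        rw [Matrix.vecMul_vecMul, ← matH_mul, mul_inv_cancel, matH_one, Matrix.vecMul_one]
      continuous_toFun := continuous_vecMul_const _
      continuous_invFun := continuous_vecMul_const _ }
  exact hΦ.2.comp_homeomorph e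

theorem IsSchwartzBruhat.integrable {Φ : (Fin 2 → ℚ_[p]) → ℂ} (hΦ : IsSchwartzBruhat Φ) :
    Integrable Φ (haarPlane p) :=
  hΦ.1.continuous.integrable_of_hasCompactSupport hΦ.2

theorem fourier_zero (ψ : AddChar ℚ_[p] Circle) (Φ : (Fin 2 → ℚ_[p]) → ℂ) :
    fourier ψ Φ 0 = ∫ v, Φ v ∂haarPlane p := by
  simp [fourier]

/-- The transform at 0 is the integral, which translation by h multiplies by |det h|. This supplies
all the functions to which the hypothesis of part (2) is applied. -/
theorem fourier_translate_sub (ψ : AddChar ℚ_[p] Circle) {Φ : (Fin 2 → ℚ_[p]) → ℂ}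
    (hΦ : IsSchwartzBruhat Φ) (h : H p D) :
    fourier ψ (fun v => Φ (Matrix.vecMul v (matH h⁻¹)) + -(‖(detH h : ℚ_[p])‖ : ℂ) * Φ v) 0 = 0 := by
  rw [fourier_zero, integral_add (hΦ.translate h).integrable (hΦ.const_mul _).integrable,
    integral_comp_vecMul (det_matH_ne_zero _) Φ hΦ.1, integral_const_mul]
  have h1 : ‖(matH h⁻¹).det‖⁻¹ = ‖(detH h : ℚ_[p])‖ := by
    rw [← det_matH, inv_eq_iff_eq_inv, ← norm_inv]
    congr 1
    refine eq_inv_of_mul_eq_one_left ?_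
    rw [← Matrix.det_mul, ← matH_mul, inv_mul_cancel, matH_one, Matrix.det_one]
  rw [h1]
  ring

end SchwartzClosure

/-! ### Calculus of the values of the local integral. -/

section Values

variable {p : ℕ} [Fact p.Prime] {D : ℕ} {V : Type*} [AddCommGroup V] [Module ℂ V]
  {ν₁ : ℚ_[p]ˣ →* ℂˣ} {ψ : AddChar ℚ_[p] Circle} {π : Representation ℂ (G p D) V}
  {Λ : V →ₗ[ℂ] ℂ} {hΛ : IsWhittakerFunctional ψ π Λ} {m : Measure (U2H p D)}

theorem integrand_mk (Φ : (Fin 2 → ℚ_[p]) → ℂ) (φ : V) (s : ℂ) (g : H p D) :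
    integrand ν₁ Φ hΛ φ s (U2H.mk g) = (ν₁ (detH g) : ℂ) * (‖(detH g : ℚ_[p])‖ : ℂ) ^ s *
      Φ (Matrix.vecMul ![0, 1] (matH g)) * Λ (π (embed p D g) φ) := rfl

theorem integrand_add_left (Φ Ψ : (Fin 2 → ℚ_[p]) → ℂ) (φ : V) (s : ℂ) (x : U2H p D) :
    integrand ν₁ (fun v => Φ v + Ψ v) hΛ φ s x =
      integrand ν₁ Φ hΛ φ s x + integrand ν₁ Ψ hΛ φ s x := by
  obtain ⟨g, rfl⟩ := U2H.mk_surjective x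
  simp only [integrand_mk]
  ring

theorem integrand_const_mul (Φ : (Fin 2 → ℚ_[p]) → ℂ) (a : ℂ) (φ : V) (s : ℂ) (x : U2H p D) :
    integrand ν₁ (fun v => a * Φ v) hΛ φ s x = a * integrand ν₁ Φ hΛ φ s x := by
  obtain ⟨g, rfl⟩ := U2H.mk_surjective x
  simp only [integrand_mk]
  ring

theorem integrand_add_right (Φ : (Fin 2 → ℚ_[p]) → ℂ) (φ₁ φ₂ : V) (s : ℂ) (x : U2H p D) :
    integrand ν₁ Φ hΛ (φ₁ + φ₂) s x = integrand ν₁ Φ hΛ φ₁ s x + integrand ν₁ Φ hΛ φ₂ s x := by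
  obtain ⟨g, rfl⟩ := U2H.mk_surjective x
  simp only [integrand_mk, map_add]
  ring

theorem integrand_smul (Φ : (Fin 2 → ℚ_[p]) → ℂ) (a : ℂ) (φ : V) (s : ℂ) (x : U2H p D) :
    integrand ν₁ Φ hΛ (a • φ) s x = a * integrand ν₁ Φ hΛ φ s x := by
  obtain ⟨g, rfl⟩ := U2H.mk_surjective x
  simp only [integrand_mk, map_smul, smul_eq_mul]
  ring

/-- The pointwise form of the substitution g ↦ gh: moving h from φ to Φ costs the inverse of the
factor ν₁(det h)|det h|ˢ. -/
theorem integrand_translate (Φ : (Fin 2 → ℚ_[p]) → ℂ) (h : H p D) (φ : V) (s : ℂ) (x : U2H p D) :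
    integrand ν₁ Φ hΛ (π (embed p D h) φ) s x =
      ((ν₁ (detH h) : ℂ)⁻¹ * (‖(detH h : ℚ_[p])‖ : ℂ) ^ (-s)) *
        integrand ν₁ (fun v => Φ (Matrix.vecMul v (matH h⁻¹))) hΛ φ s (U2H.translate h x) := by
  obtain ⟨g, rfl⟩ := U2H.mk_surjective x
  have h0 : (‖(detH h : ℚ_[p])‖ : ℂ) ≠ 0 := by
    exact_mod_cast (norm_pos_iff.2 (detH h).ne_zero).ne'
  have h1 : (‖(detH h : ℚ_[p])‖ : ℂ) ^ s ≠ 0 := by simp [Complex.cpow_eq_zero_iff, h0]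
  have h2 : (ν₁ (detH h) : ℂ) ≠ 0 := Units.ne_zero _
  rw [U2H.translate_mk, integrand_mk, integrand_mk, Matrix.vecMul_vecMul, matH_mul,
    Matrix.mul_assoc, matH_mul_matH_inv, Matrix.mul_one, detH_mul, map_mul, Units.val_mul, Units.val_mul, norm_mul,
    Complex.ofReal_mul, Complex.mul_cpow_ofReal_nonneg (norm_nonneg _) (norm_nonneg _), map_mul,
    map_mul, Module.End.mul_apply, Complex.cpow_neg]
  field_simp

theorem LocalIntegralHasValue.unique {Φ : (Fin 2 → ℚ_[p]) → ℂ} {φ : V} {s₀ c c' : ℂ}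
    (h : LocalIntegralHasValue m ν₁ Φ hΛ φ s₀ c) (h' : LocalIntegralHasValue m ν₁ Φ hΛ φ s₀ c') :
    c = c' := by
  obtain ⟨σ, -, F, hF, hFI, hFa, rfl⟩ := h
  obtain ⟨σ', -, F', hF', hFI', hFa', rfl⟩ := h'
  have := eq_zero_of_meromorphic (F := fun s => F s - F' s) (fun x => (hF x).sub (hF' x))
    (σ := max σ σ') (fun s hs => by
      rw [hFI s ((le_max_left _ _).trans_lt hs), hFI' s ((le_max_right _ _).trans_lt hs), sub_self])
    (hFa.sub hFa')
  exact sub_eq_zero.1 this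

theorem LocalIntegralHasValue.of_add {Φ Φ₁ Φ₂ : (Fin 2 → ℚ_[p]) → ℂ} {φ φ₁ φ₂ : V} {s₀ c₁ c₂ : ℂ}
    (h₁ : LocalIntegralHasValue m ν₁ Φ₁ hΛ φ₁ s₀ c₁)
    (h₂ : LocalIntegralHasValue m ν₁ Φ₂ hΛ φ₂ s₀ c₂)
    (h : ∀ s x, integrand ν₁ Φ hΛ φ s x =
      integrand ν₁ Φ₁ hΛ φ₁ s x + integrand ν₁ Φ₂ hΛ φ₂ s x) :
    LocalIntegralHasValue m ν₁ Φ hΛ φ s₀ (c₁ + c₂) := by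
  obtain ⟨σ, hi, F, hF, hFI, hFa, rfl⟩ := h₁
  obtain ⟨σ', hi', F', hF', hFI', hFa', rfl⟩ := h₂
  refine ⟨max σ σ', fun s hs => ?_, fun s => F s + F' s, fun x => (hF x).add (hF' x),
    fun s hs => ?_, hFa.add hFa', rfl⟩
  · have := (hi s ((le_max_left _ _).trans_lt hs)).add (hi' s ((le_max_right _ _).trans_lt hs))
    exact this.congr (ae_of_all _ fun x => (h s x).symm)
  · beta_reduce
    rw [hFI s ((le_max_left _ _).trans_lt hs), hFI' s ((le_max_right _ _).trans_lt hs)]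
    simp only [localIntegral, h]
    exact (integral_add (hi s ((le_max_left _ _).trans_lt hs))
      (hi' s ((le_max_right _ _).trans_lt hs))).symm

/-- Common source of two rules: k exponential in s for translation by `H`, and k constant with t = 1
for scalar multiples. -/
theorem LocalIntegralHasValue.of_mul (hm : IsInvariantMeasure m) {Φ Φ₁ : (Fin 2 → ℚ_[p]) → ℂ}
    {φ φ₁ : V} {s₀ c : ℂ} (h₁ : LocalIntegralHasValue m ν₁ Φ₁ hΛ φ₁ s₀ c) {k : ℂ → ℂ}
    (hk : Differentiable ℂ k) (t : H p D)
    (h : ∀ s x, integrand ν₁ Φ hΛ φ s x = k s * integrand ν₁ Φ₁ hΛ φ₁ s (U2H.translate t x)) :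
    LocalIntegralHasValue m ν₁ Φ hΛ φ s₀ (k s₀ * c) := by
  obtain ⟨σ, hi, F, hF, hFI, hFa, rfl⟩ := h₁
  refine ⟨σ, fun s hs => ?_, fun s => k s * F s, fun x => (hk.analyticAt x).meromorphicAt.mul (hF x),
    fun s hs => ?_, (hk.analyticAt s₀).mul hFa, rfl⟩
  · have := ((hm.measurePreserving t).integrable_comp_emb
      (U2H.measurableEmbedding_translate t)).2 (hi s hs)
    exact (this.const_mul (k s)).congr (ae_of_all _ fun x => (h s x).symm)
  · beta_reduce
    rw [hFI s hs]
    simp only [localIntegral, h]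
    rw [integral_const_mul, (hm.measurePreserving t).integral_comp
      (U2H.measurableEmbedding_translate t)]

theorem LocalIntegralHasValue.translate (hm : IsInvariantMeasure m) {Φ : (Fin 2 → ℚ_[p]) → ℂ}
    {φ : V} {s₀ c : ℂ} (h : H p D)
    (hc : LocalIntegralHasValue m ν₁ (fun v => Φ (Matrix.vecMul v (matH h⁻¹))) hΛ φ s₀ c) :
    LocalIntegralHasValue m ν₁ Φ hΛ (π (embed p D h) φ) s₀
      (((ν₁ (detH h) : ℂ)⁻¹ * (‖(detH h : ℚ_[p])‖ : ℂ) ^ (-s₀)) * c) := by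
  refine hc.of_mul hm (k := fun s => (ν₁ (detH h) : ℂ)⁻¹ * (‖(detH h : ℚ_[p])‖ : ℂ) ^ (-s)) ?_ h
    fun s x => integrand_translate Φ h φ s x
  have h0 : (‖(detH h : ℚ_[p])‖ : ℂ) ≠ 0 := by
    exact_mod_cast (norm_pos_iff.2 (detH h).ne_zero).ne'
  exact (differentiable_id.neg.const_cpow (Or.inl h0)).const_mul _

theorem LocalIntegralHasValue.const_mul (hm : IsInvariantMeasure m) {Φ : (Fin 2 → ℚ_[p]) → ℂ}
    {φ : V} {s₀ c : ℂ} (a : ℂ) (h : LocalIntegralHasValue m ν₁ Φ hΛ φ s₀ c) :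
    LocalIntegralHasValue m ν₁ (fun v => a * Φ v) hΛ φ s₀ (a * c) :=
  h.of_mul hm (k := fun _ => a) (differentiable_const a) 1 fun s x => by
    rw [U2H.translate_one, integrand_const_mul]

theorem LocalIntegralHasValue.smul (hm : IsInvariantMeasure m) {Φ : (Fin 2 → ℚ_[p]) → ℂ}
    {φ : V} {s₀ c : ℂ} (a : ℂ) (h : LocalIntegralHasValue m ν₁ Φ hΛ φ s₀ c) :
    LocalIntegralHasValue m ν₁ Φ hΛ (a • φ) s₀ (a * c) :=
  h.of_mul hm (k := fun _ => a) (differentiable_const a) 1 fun s x => by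
    rw [U2H.translate_one, integrand_smul]

end Values

/-! ### Additive and multiplicative characters of ℚ_p. -/

section Characters

variable {p : ℕ} [Fact p.Prime]

theorem AddChar.natCast_mul_eq_pow (ψ : AddChar ℚ_[p] Circle) (n : ℕ) (x : ℚ_[p]) :
    ψ (n * x) = ψ x ^ n := by
  rw [← nsmul_eq_mul, AddChar.map_nsmul_eq_pow]

/-- The kernel of a nontrivial continuous additive character of `ℚ_p` is bounded. -/
theorem exists_norm_le_of_apply_eq_one {ψ : AddChar ℚ_[p] Circle} (hψ : Continuous ψ)
    (hψ1 : ψ ≠ 1) : ∃ R : ℝ, ∀ x, ψ x = 1 → ‖x‖ ≤ R := by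
  by_contra! hcon
  refine hψ1 (DFunLike.ext _ _ fun y => ?_)
  obtain ⟨x, hx, hxy⟩ := hcon ‖y‖
  have hx0 : x ≠ 0 := norm_pos_iff.1 ((norm_nonneg y).trans_lt hxy)
  -- If ψ(x) = 1 then ψ is trivial on ℕx, which is dense in ℤ_p x; and y lies in ℤ_p x because ‖y‖ <
  -- ‖x‖.
  have hint : (fun z : ℤ_[p] => ψ (z * x)) = fun _ => 1 := by
    refine Continuous.ext_on (PadicInt.denseRange_natCast (p := p))
      (hψ.comp (continuous_subtype_val.mul continuous_const)) continuous_const ?_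
    rintro _ ⟨n, rfl⟩
    change ψ (((n : ℤ_[p]) : ℚ_[p]) * x) = 1
    rw [PadicInt.coe_natCast, AddChar.natCast_mul_eq_pow, hx, one_pow]
  have hz : ‖y / x‖ ≤ 1 := by
    rw [norm_div, div_le_one (norm_pos_iff.2 hx0)]
    exact hxy.le
  have h1 : ψ (y / x * x) = 1 := congrFun hint ⟨y / x, hz⟩
  rw [div_mul_cancel₀ _ hx0] at h1
  rw [h1]
  rfl

theorem sum_pow_of_pow_eq_one {z : ℂ} {q : ℕ} (hz : z ^ q = 1) :
    ∑ j ∈ Finset.range q, z ^ j = if z = 1 then (q : ℂ) else 0 := by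
  split_ifs with h
  · simp [h]
  · rw [geom_sum_eq h, hz, sub_self, zero_div]

theorem norm_eq_one_mem_nhds : {t : ℚ_[p]ˣ | ‖(t : ℚ_[p])‖ = 1} ∈ 𝓝 1 := by
  have h1 := (isOpen_norm_le (Units.continuous_val (M := ℚ_[p])) one_ne_zero).mem_nhds
    (x := 1) (by simp)
  have h2 := (isOpen_norm_le (Units.continuous_coe_inv (M := ℚ_[p])) one_ne_zero).mem_nhds
    (x := 1) (by simp)
  filter_upwards [h1, h2] with t ht ht'
  have ht2 : ‖((t⁻¹ : ℚ_[p]ˣ) : ℚ_[p])‖ ≤ 1 := ht'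
  rw [Units.val_inv_eq_inv_val, norm_inv] at ht2
  exact le_antisymm ht ((inv_le_one₀ (norm_pos_iff.2 t.ne_zero)).1 ht2)

end Characters

/-! ### Whittaker functions on the torus and their truncation. -/

section Whittaker

variable {p : ℕ} [Fact p.Prime] {D : ℕ} {V : Type*} [AddCommGroup V] [Module ℂ V]
  {ψ : AddChar ℚ_[p] Circle} {π : Representation ℂ (G p D) V} {Λ : V →ₗ[ℂ] ℂ}

theorem isUpperUnipotent_unip (hD : D ≠ 0) (c : Ep p D) : IsUpperUnipotent (unip hD c) := by
  constructor
  · intro i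
    fin_cases i <;> simp [matG, unip]
  · intro i j hij
    fin_cases i <;> fin_cases j <;> first | rfl | (simp at hij)

theorem embed_torus_mul_unip (hD : D ≠ 0) (z : (Ep p D)ˣ) (c : Ep p D) :
    embed p D (torus z) * unip hD c = unip hD ((z : Ep p D) * c) * embed p D (torus z) := by
  have hN := QuadraticAlgebra.algebraMap_norm_eq_mul_star (z : Ep p D)
  have hcor : corner ((z : Ep p D) * c) =
      algebraMap ℚ_[p] (Ep p D) (QuadraticAlgebra.norm (z : Ep p D)) * corner c := by
    ext <;> simp [corner]
    ring
  refine Subtype.ext (Prod.ext (Units.ext ?_) (mul_comm _ _))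
  change blockHom p D (matH (torus z), z) * (unip hD c).1.1.1 =
    (unip hD ((z : Ep p D) * c)).1.1.1 * blockHom p D (matH (torus z), z)
  refine Matrix.ext fun i j => ?_
  fin_cases i <;> fin_cases j <;>
    simp [Matrix.mul_apply, Fin.sum_univ_succ, blockHom, unip, matH, torus, hcor]
  · rw [hN]; ring

theorem trace_deltaInv_mul (hD : D ≠ 0) (w : Ep p D) :
    QuadraticAlgebra.trace (deltaInv p D * w) = 2 * w.im := by
  have hD' : (D : ℚ_[p]) ≠ 0 := by exact_mod_cast hD
  simp [QuadraticAlgebra.trace, deltaInv]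
  field_simp

/-- Moving the unipotent element to the left of the torus element replaces c by zc. Thus right
translation by U_B multiplies the Whittaker function on the torus by additive characters of z. -/
theorem whittaker_torus_unip (hD : D ≠ 0) (hΛ : IsWhittakerFunctional ψ π Λ) (z : (Ep p D)ˣ)
    (c : Ep p D) (φ : V) :
    Λ (π (embed p D (torus z)) (π (unip hD c) φ)) =
      (ψ (2 * (z * c : Ep p D).im) : ℂ) * Λ (π (embed p D (torus z)) φ) := by
  rw [← Module.End.mul_apply, ← map_mul, embed_torus_mul_unip, map_mul, Module.End.mul_apply,
    hΛ.equivariant _ (isUpperUnipotent_unip hD _), ← trace_deltaInv_mul hD]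
  rfl

theorem IsSmooth.isLocallyConstant (hπ : IsSmooth π) (φ : V) :
    IsLocallyConstant fun g : G p D => π g φ := by
  rw [IsLocallyConstant.iff_exists_open]
  intro g₀
  refine ⟨(fun g => g₀⁻¹ * g) ⁻¹' {g | π g φ = φ}, (hπ φ).preimage (continuous_const_mul _), ?_, ?_⟩
  · simp
  · intro g hg
    have h1 : π (g₀⁻¹ * g) φ = φ := hg
    have h2 : g = g₀ * (g₀⁻¹ * g) := by group
    rw [h2, map_mul, Module.End.mul_apply, h1]

theorem IsSmooth.eventually {X : Type*} [TopologicalSpace X] (hπ : IsSmooth π) (φ : V)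
    {f : X → G p D} (hf : Continuous f) {x : X} (hx : f x = 1) :
    ∀ᶠ y in 𝓝 x, π (f y) φ = φ :=
  ((hπ φ).preimage hf).mem_nhds (by simp [hx])

theorem exists_unip_fixes (hD : D ≠ 0) (hπ : IsSmooth π) (φ : V) :
    ∃ ε > 0, ∀ a b : ℚ_[p], ‖a‖ < ε → ‖b‖ < ε → π (unip hD ⟨a, b⟩) φ = φ := by
  have h : {c : Ep p D | π (unip hD c) φ = φ} ∈ 𝓝 0 :=
    hπ.eventually φ (continuous_unip hD) (unip_zero hD)
  generalize hS : {c : Ep p D | π (unip hD c) φ = φ} = S at h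
  have hS' : ∀ c ∈ S, π (unip hD c) φ = φ := fun c hc => by rw [← hS] at hc; exact hc
  rw [nhds_induced, mem_comap] at h
  obtain ⟨T, hT, hTS⟩ := h
  obtain ⟨ε, hε, hεT⟩ := Metric.mem_nhds_iff.1 hT
  refine ⟨ε, hε, fun a b ha hb => hS' _ (hTS (hεT ?_))⟩
  rw [Metric.mem_ball, Prod.dist_eq, max_lt_iff, dist_eq_norm, dist_eq_norm]
  change ‖a - 0‖ < ε ∧ ‖b - 0‖ < ε
  rw [sub_zero, sub_zero]
  exact ⟨ha, hb⟩

open scoped Classical in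
/-- Twisted averages over `U_B` cut the restriction of a Whittaker function to the torus down to
a neighbourhood of `1`. -/
theorem exists_truncation (hD : D ≠ 0) (hπ : IsSmooth π) (hΛ : IsWhittakerFunctional ψ π Λ)
    {φ₀ : V} (hφ₀ : Λ φ₀ ≠ 0) (e : ℚ_[p]) :
    ∃ φ : V, ∀ z : (Ep p D)ˣ, Λ (π (embed p D (torus z)) φ) =
      (if ψ (2 * e * (z : Ep p D).im) = 1 then 1 else 0) *
        (if ψ (2 * e * ((z : Ep p D).re - 1)) = 1 then 1 else 0) *
        Λ (π (embed p D (torus z)) φ₀) := by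
  obtain ⟨ε, hε, hfix⟩ := exists_unip_fixes hD hπ φ₀
  obtain ⟨K, hK⟩ : ∃ K : ℕ, ‖((p ^ K : ℕ) : ℚ_[p]) * e‖ < ε := by
    have h1 : Tendsto (fun K : ℕ => ‖(p : ℚ_[p])‖ ^ K * ‖e‖) atTop (𝓝 (0 * ‖e‖)) :=
      (tendsto_pow_atTop_nhds_zero_of_lt_one (norm_nonneg _) Padic.norm_p_lt_one).mul_const _
    rw [zero_mul] at h1
    obtain ⟨K, hK⟩ := (h1.eventually_lt_const hε).exists
    exact ⟨K, by simpa using hK⟩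
  set q := p ^ K with hq
  have hq0 : (q : ℂ) ≠ 0 := by
    have := (Fact.out : p.Prime).ne_zero
    exact_mod_cast pow_ne_zero K this
  -- The unipotents with parameters qe and qeδ fix φ₀, so wherever the Whittaker function is nonzero
  -- the characters they produce are trivial. Hence the numbers averaged below are q-th roots of
  -- unity.
  have hper : ∀ z : (Ep p D)ˣ, Λ (π (embed p D (torus z)) φ₀) ≠ 0 →
      ψ (q * (2 * e * (z : Ep p D).im)) = 1 ∧ ψ (q * (2 * e * (z : Ep p D).re)) = 1 := by
    intro z hz
    have h0 : ‖(0 : ℚ_[p])‖ < ε := by simpa using hε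
    have key : ∀ a b : ℚ_[p], ‖a‖ < ε → ‖b‖ < ε → ψ (2 * (z * ⟨a, b⟩ : Ep p D).im) = 1 := by
      intro a b ha hb
      have h1 := whittaker_torus_unip hD hΛ z ⟨a, b⟩ φ₀
      rw [hfix a b ha hb] at h1
      have h2 : (ψ (2 * (z * ⟨a, b⟩ : Ep p D).im) : ℂ) = 1 :=
        mul_right_cancel₀ hz (h1.symm.trans (one_mul _).symm)
      exact Circle.coe_eq_one.1 h2
    constructor
    · have := key (q * e) 0 hK h0
      rw [← this]
      congr 1
      simp
      ring
    · have := key 0 (q * e) h0 hK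
      rw [← this]
      congr 1
      simp
      ring
  have hone : ψ (q * (2 * e)) = 1 := by
    have := (hper 1 (by simpa [torus_one] using hφ₀)).2
    simpa [QuadraticAlgebra.re_one] using this
  -- The sum over j detects im z, and that over k detects re z; the twist ψ(-2ek) centres the second
  -- condition at re z = 1.
  refine ⟨((q : ℂ) ^ 2)⁻¹ • ∑ j ∈ Finset.range q, ∑ k ∈ Finset.range q,
    (ψ (-(2 * e * k)) : ℂ) • π (unip hD ⟨j * e, k * e⟩) φ₀, fun z => ?_⟩
  have hterm : ∀ j k : ℕ, (ψ (-(2 * e * k)) : ℂ) *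
      Λ (π (embed p D (torus z)) (π (unip hD ⟨j * e, k * e⟩) φ₀)) =
      (ψ (2 * e * (z : Ep p D).im) : ℂ) ^ j * (ψ (2 * e * ((z : Ep p D).re - 1)) : ℂ) ^ k *
        Λ (π (embed p D (torus z)) φ₀) := by
    intro j k
    rw [whittaker_torus_unip hD hΛ, ← mul_assoc]
    congr 1
    have h3 : ψ (-(2 * e * k)) * ψ (2 * (z * ⟨j * e, k * e⟩ : Ep p D).im) =
        ψ (2 * e * (z : Ep p D).im) ^ j * ψ (2 * e * ((z : Ep p D).re - 1)) ^ k := by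
      rw [← AddChar.natCast_mul_eq_pow, ← AddChar.natCast_mul_eq_pow, ← AddChar.map_add_eq_mul,
        ← AddChar.map_add_eq_mul]
      congr 1
      simp
      ring
    exact_mod_cast congrArg (Subtype.val : Circle → ℂ) h3
  simp only [map_smul, map_sum, smul_eq_mul, hterm]
  by_cases hz : Λ (π (embed p D (torus z)) φ₀) = 0
  · simp [hz]
  obtain ⟨h1, h2⟩ := hper z hz
  have hz1 : (ψ (2 * e * (z : Ep p D).im) : ℂ) ^ q = 1 := by
    rw [AddChar.natCast_mul_eq_pow] at h1
    rw [← Circle.coe_pow, h1, Circle.coe_one]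
  have hz2 : (ψ (2 * e * ((z : Ep p D).re - 1)) : ℂ) ^ q = 1 := by
    have h3 : ψ (q * (2 * e * ((z : Ep p D).re - 1))) = 1 := by
      rw [mul_sub, mul_sub, mul_one, AddChar.map_sub_eq_div, h2, hone, div_one]
    rw [AddChar.natCast_mul_eq_pow] at h3
    rw [← Circle.coe_pow, h3, Circle.coe_one]
  simp only [← Finset.sum_mul, ← Finset.mul_sum]
  rw [sum_pow_of_pow_eq_one hz1, sum_pow_of_pow_eq_one hz2]
  simp only [Circle.coe_eq_one]
  split_ifs <;> field_simp <;> simp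

theorem exists_of_mem_nhds_one {U : Set (Ep p D)ˣ} (hU : U ∈ 𝓝 1) :
    ∃ η > 0, ∀ z : (Ep p D)ˣ, ‖(z : Ep p D).re - 1‖ < η → ‖(z : Ep p D).im‖ < η → z ∈ U := by
  rw [isEmbedding_val_ep.nhds_eq_comap, nhds_induced, comap_comap, mem_comap] at hU
  obtain ⟨T, hT, hTU⟩ := hU
  obtain ⟨η, hη, hηT⟩ := Metric.mem_nhds_iff.1 hT
  refine ⟨η, hη, fun z h1 h2 => hTU (hηT ?_)⟩
  rw [Metric.mem_ball, Prod.dist_eq, max_lt_iff, dist_eq_norm, dist_eq_norm]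
  refine ⟨h1, ?_⟩
  change ‖(z : Ep p D).im - 0‖ < η
  rwa [sub_zero]

theorem exists_of_mem_nhds_zero_one {U : Set (ℚ_[p] × ℚ_[p]ˣ)} (hU : U ∈ 𝓝 (0, 1)) :
    ∃ η > 0, ∀ (c : ℚ_[p]) (d : ℚ_[p]ˣ), ‖c‖ < η → ‖(d : ℚ_[p]) - 1‖ < η → (c, d) ∈ U := by
  rw [nhds_prod_eq, Units.isEmbedding_val₀.nhds_eq_comap, mem_prod_iff] at hU
  obtain ⟨A, hA, B, hB, hAB⟩ := hU
  rw [mem_comap] at hB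
  obtain ⟨T, hT, hTB⟩ := hB
  obtain ⟨a, ha, haA⟩ := Metric.mem_nhds_iff.1 hA
  obtain ⟨b, hb, hbT⟩ := Metric.mem_nhds_iff.1 hT
  refine ⟨min a b, lt_min ha hb, fun c d h1 h2 => hAB ⟨haA ?_, hTB (hbT ?_)⟩⟩
  · simpa using h1.trans_le (min_le_left _ _)
  · rw [Metric.mem_ball, dist_eq_norm]
    exact h2.trans_le (min_le_right _ _)

theorem continuous_centerZ : Continuous (centerZ p D) := by
  refine Continuous.subtype_mk (Continuous.prodMk (Units.continuous_iff.2 ⟨?_, ?_⟩)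
    (Units.continuous_iff.2 ⟨?_, ?_⟩)) _
  · exact (continuous_pi fun _ => Units.continuous_val).matrix_diagonal
  · exact (continuous_pi fun _ => Units.continuous_coe_inv).matrix_diagonal
  · exact continuous_algebraMap_ep.comp Units.continuous_val
  · exact continuous_algebraMap_ep.comp Units.continuous_coe_inv

/-- Smoothness makes ω trivial near 1, so ν₁² = 1 there, and continuity excludes the value -1. -/
theorem eventually_character_eq_one (hπ : IsSmooth π) {φ₀ : V} (hφ₀ : φ₀ ≠ 0)
    {ω ν₁ : ℚ_[p]ˣ →* ℂˣ}
    (hω : ∀ (t : ℚ_[p]ˣ) (v : V), π (embed p D (centerZ p D t)) v = (ω t : ℂ) • v)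
    (hν₁ : Continuous ν₁) (hνω : ν₁ ^ 2 * ω = 1) : ∀ᶠ t in 𝓝 (1 : ℚ_[p]ˣ), ν₁ t = 1 := by
  have h1 := hπ.eventually φ₀ (continuous_embed.comp (continuous_centerZ (p := p) (D := D)))
    (x := 1) (by simp)
  have h2 : ∀ᶠ t in 𝓝 (1 : ℚ_[p]ˣ), (ν₁ t : ℂ) ≠ -1 := by
    have hc : Continuous fun t => (ν₁ t : ℂ) := Units.continuous_val.comp hν₁
    refine hc.continuousAt.eventually_ne ?_
    simp only [map_one, Units.val_one, ne_eq]
    norm_num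
  filter_upwards [h1, h2] with t ht ht'
  have h3 : (ω t : ℂ) = 1 := by
    have h4 : (ω t : ℂ) • φ₀ = (1 : ℂ) • φ₀ := by rw [← hω, one_smul]; exact ht
    exact smul_left_injective ℂ hφ₀ h4
  have h5 : (ν₁ t : ℂ) ^ 2 * (ω t : ℂ) = 1 := by
    have := congrArg (fun χ : ℚ_[p]ˣ →* ℂˣ => (χ t : ℂ)) hνω
    simpa using this
  rw [h3, mul_one] at h5
  exact Units.ext ((sq_eq_one_iff.1 h5).resolve_right ht')

end Whittaker

/-! ### The test vector and test function with nonzero constant integral. -/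

section TestData

variable {p : ℕ} [Fact p.Prime] {D : ℕ} {V : Type*} [AddCommGroup V] [Module ℂ V]
  {ν₁ : ℚ_[p]ˣ →* ℂˣ} {ψ : AddChar ℚ_[p] Circle} {π : Representation ℂ (G p D) V}
  {Λ : V →ₗ[ℂ] ℂ} {m : Measure (U2H p D)}

/-- The box of radius `r` around `(0, 1)`. -/
def box (p : ℕ) [Fact p.Prime] (r : ℝ) : Set (Fin 2 → ℚ_[p]) := {v | ‖v 0‖ ≤ r ∧ ‖v 1 - 1‖ ≤ r}

theorem isClopen_box {r : ℝ} (hr : 0 < r) : IsClopen (box p r) := by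
  constructor
  · exact (isClosed_le (continuous_apply 0).norm continuous_const).inter
      (isClosed_le ((continuous_apply 1).sub continuous_const).norm continuous_const)
  · exact (isOpen_norm_le (continuous_apply 0) hr.ne').inter
      (isOpen_norm_le ((continuous_apply 1).sub continuous_const) hr.ne')

/-- The characteristic function of the box of radius `r` around `(0, 1)`. -/
noncomputable def boxFun (p : ℕ) [Fact p.Prime] (r : ℝ) : (Fin 2 → ℚ_[p]) → ℂ :=
  (box p r).indicator fun _ => 1

theorem isSchwartzBruhat_boxFun {r : ℝ} (hr : 0 < r) : IsSchwartzBruhat (boxFun p r) := by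
  constructor
  · exact (LocallyConstant.charFn ℂ (isClopen_box (p := p) hr)).isLocallyConstant
  · refine HasCompactSupport.intro (isCompact_closedBall ![0, 1] r) fun v hv => ?_
    refine Set.indicator_of_notMem (fun hv' => hv ?_) _
    rw [mem_closedBall_iff_norm, pi_norm_le_iff_of_nonneg hr.le, Fin.forall_fin_two]
    simpa [box] using hv'

theorem boxFun_zero {r : ℝ} (hr : r < 1) : boxFun p r 0 = 0 := by
  refine Set.indicator_of_notMem (fun h => ?_) _
  have h2 : ‖(0 : ℚ_[p]) - 1‖ ≤ r := h.2
  rw [zero_sub, norm_neg, norm_one] at h2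
  linarith

theorem norm_eq_one_of_mem_box {r : ℝ} (hr : r < 1) {v : Fin 2 → ℚ_[p]} (hv : v ∈ box p r) :
    ‖v 1‖ = 1 := by
  have h1 : ‖v 1 - 1‖ < 1 := hv.2.trans_lt hr
  have h2 := IsUltrametricDist.norm_add_eq_max_of_norm_ne_norm
    (x := v 1 - 1) (y := 1) (by rw [norm_one]; exact h1.ne)
  rw [sub_add_cancel, norm_one, max_eq_right h1.le] at h2
  exact h2

theorem vecMul_matH (h : H p D) : Matrix.vecMul ![0, 1] (matH h) = ![matH h 1 0, matH h 1 1] := by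
  ext i
  fin_cases i <;> simp [Matrix.vecMul, dotProduct]

/-- A coset in `U₂ \ H` is determined by the bottom row and by `λ`. -/
theorem U2H.mk_eq_mk {g h : H p D} (h0 : matH g 1 0 = matH h 1 0) (h1 : matH g 1 1 = matH h 1 1)
    (hz : g.1.2 = h.1.2) : U2H.mk g = U2H.mk h := by
  refine Quotient.sound (s := QuotientGroup.rightRel (U2 p D)) ?_
  rw [← Quotient.eq_iff_equiv, Quotient.eq, QuotientGroup.rightRel_apply]
  have hrow : Matrix.vecMul ![0, 1] (matH (h * g⁻¹)) = ![0, 1] := by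
    have h2 : Matrix.vecMul ![0, 1] (matH h) = Matrix.vecMul ![0, 1] (matH g) := by
      rw [vecMul_matH, vecMul_matH, h0, h1]
    rw [matH_mul, ← Matrix.vecMul_vecMul, h2, Matrix.vecMul_vecMul, matH_mul_matH_inv,
      Matrix.vecMul_one]
  rw [vecMul_matH] at hrow
  have h10 : matH (h * g⁻¹) 1 0 = 0 := by simpa using congrFun hrow 0
  have h11 : matH (h * g⁻¹) 1 1 = 1 := by simpa using congrFun hrow 1
  have hlam : (h * g⁻¹).1.2 = 1 := by
    change h.1.2 * g.1.2⁻¹ = 1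
    rw [hz, mul_inv_cancel]
  have hdet : (matH (h * g⁻¹)).det = 1 := by
    rw [det_matH, detH_eq_norm, hlam, Units.val_one, map_one]
  rw [Matrix.det_fin_two, h10, h11, mul_one, mul_zero, sub_zero] at hdet
  exact ⟨hlam, hdet, h10, h11⟩

theorem matH_torus_mul_lower (z : (Ep p D)ˣ) (c : ℚ_[p]) (d : ℚ_[p]ˣ) :
    matH (torus z * lower c d) 1 0 = c ∧ matH (torus z * lower c d) 1 1 = d := by
  rw [matH_mul]
  constructor <;> simp [matH, torus, lower, Matrix.mul_apply]

theorem detH_torus_mul_lower (z : (Ep p D)ˣ) (c : ℚ_[p]) (d : ℚ_[p]ˣ) :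
    detH (torus z * lower c d) = detH (torus z : H p D) := by
  refine Units.ext ?_
  rw [detH_eq_norm, detH_eq_norm]
  change QuadraticAlgebra.norm ((z * 1 : (Ep p D)ˣ) : Ep p D) =
    QuadraticAlgebra.norm (z : Ep p D)
  rw [mul_one]

theorem continuous_integrandH_zero (hν₁ : Continuous ν₁) (hπ : IsSmooth π) {r : ℝ} (hr : 0 < r)
    (φ : V) : Continuous (integrandH ν₁ (boxFun p r) (whittaker π Λ φ) 0) := by
  have h1 : Continuous fun g : H p D => (ν₁ (detH g) : ℂ) :=
    Units.continuous_val.comp (hν₁.comp continuous_detH)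
  have h2 : Continuous fun g : H p D => boxFun p r (Matrix.vecMul ![0, 1] (matH g)) :=
    (isSchwartzBruhat_boxFun hr).1.continuous.comp
      (continuous_const.matrix_vecMul (Units.continuous_val.comp continuous_fst_H))
  have h3 : Continuous fun g : H p D => Λ (π (embed p D g) φ) :=
    ((hπ.isLocallyConstant φ).comp Λ).continuous.comp continuous_embed
  have h4 : integrandH ν₁ (boxFun p r) (whittaker π Λ φ) 0 = fun g : H p D =>
      (ν₁ (detH g) : ℂ) * boxFun p r (Matrix.vecMul ![0, 1] (matH g)) *
        Λ (π (embed p D g) φ) := by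
    funext g
    simp [integrandH, whittaker, detH, matH, H.proj]
  rw [h4]
  exact (h1.mul h2).mul h3

/-- There are data for which the integrand is, for every `s`, the same nonzero multiple of the
characteristic function of a nonempty open set. -/
theorem exists_test_data (hD : D ≠ 0) (hψ : Continuous ψ) (hψ1 : ψ ≠ 1) (hπ : IsSmooth π)
    (hΛ : IsWhittakerFunctional ψ π Λ) {ω : ℚ_[p]ˣ →* ℂˣ}
    (hω : ∀ (t : ℚ_[p]ˣ) (v : V), π (embed p D (centerZ p D t)) v = (ω t : ℂ) • v)
    (hν₁ : Continuous ν₁) (hνω : ν₁ ^ 2 * ω = 1) :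
    ∃ (φ : V) (r : ℝ) (S : Set (U2H p D)) (c : ℂ), 0 < r ∧ r < 1 ∧ IsOpen S ∧ S.Nonempty ∧ c ≠ 0 ∧
      ∀ s, integrand ν₁ (boxFun p r) hΛ φ s = S.indicator fun _ => c := by
  classical
  obtain ⟨φ₀, hφ₀⟩ : ∃ φ₀, Λ φ₀ ≠ 0 := by
    by_contra! h
    exact hΛ.ne_zero (LinearMap.ext h)
  have hφ₀' : φ₀ ≠ 0 := by rintro rfl; simp at hφ₀
  -- a neighbourhood of `1` in the torus on which everything is constant
  have hdt : Continuous fun z : (Ep p D)ˣ => detH (torus z) := continuous_detH.comp continuous_torus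
  have hdt1 : detH (torus 1 : H p D) = 1 := by rw [torus_one]; simp [detH]
  have hU : ∀ᶠ z in 𝓝 (1 : (Ep p D)ˣ), π (embed p D (torus z)) φ₀ = φ₀ ∧
      ‖(detH (torus z) : ℚ_[p])‖ = 1 ∧ ν₁ (detH (torus z)) = 1 := by
    refine (hπ.eventually φ₀ (continuous_embed.comp continuous_torus)
      (by simp [torus_one])).and (Filter.Eventually.and ?_ ?_)
    · have := hdt.tendsto 1
      rw [hdt1] at this
      exact this.eventually norm_eq_one_mem_nhds
    · have := hdt.tendsto 1
      rw [hdt1] at this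
      exact this.eventually (eventually_character_eq_one hπ hφ₀' hω hν₁ hνω)
  obtain ⟨η, hη, hηU⟩ := exists_of_mem_nhds_one hU
  obtain ⟨R, hR⟩ := exists_norm_le_of_apply_eq_one hψ hψ1
  -- With e this large, ψ(2ex) = 1 forces ‖x‖ < η, so the truncation lies inside the neighbourhood
  -- found above.
  obtain ⟨e, he⟩ : ∃ e : ℚ_[p], R / η < ‖2 * e‖ := by
    obtain ⟨x, hx⟩ := NormedField.exists_lt_norm ℚ_[p] (R / η)
    exact ⟨x / 2, by rwa [mul_div_cancel₀ _ two_ne_zero]⟩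
  have hsmall : ∀ x : ℚ_[p], ψ (2 * e * x) = 1 → ‖x‖ < η := by
    intro x hx
    have h1 := hR _ hx
    rw [norm_mul] at h1
    by_contra! h2
    rw [div_lt_iff₀ hη] at he
    have h3 : ‖2 * e‖ * η ≤ ‖2 * e‖ * ‖x‖ := by gcongr
    linarith
  obtain ⟨φ, hφ⟩ := exists_truncation hD hπ hΛ hφ₀ e
  -- a box on which the lower triangular part does not matter
  have hlow := hπ.eventually φ (continuous_embed.comp (continuous_lower (p := p) (D := D)))
    (x := (0, 1)) (by simp [lower_one])
  obtain ⟨ρ, hρ, hρU⟩ := exists_of_mem_nhds_zero_one hlow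
  set r := min (ρ / 2) (1 / 2) with hrdef
  have hr : 0 < r := by positivity
  have hr1 : r < 1 := (min_le_right _ _).trans_lt (by norm_num)
  have hrρ : r < ρ := (min_le_left _ _).trans_lt (by linarith)
  -- The support: bottom row in the box, λ in the truncation neighbourhood of 1. Both depend only on
  -- the coset in U₂\H.
  set P : H p D → Prop := fun h => Matrix.vecMul ![0, 1] (matH h) ∈ box p r ∧
    ψ (2 * e * (h.1.2 : Ep p D).im) = 1 ∧ ψ (2 * e * ((h.1.2 : Ep p D).re - 1)) = 1 with hP
  have key : ∀ s (h : H p D), integrand ν₁ (boxFun p r) hΛ φ s (U2H.mk h) =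
      if P h then Λ φ₀ else 0 := by
    intro s h
    by_cases hb : Matrix.vecMul ![0, 1] (matH h) ∈ box p r
    swap
    · rw [if_neg (fun hh => hb hh.1), integrand_mk, boxFun, Set.indicator_of_notMem hb]
      simp
    have hd1 := norm_eq_one_of_mem_box hr1 hb
    rw [vecMul_matH] at hd1
    have hd0 : matH h 1 1 ≠ 0 := by
      rintro h0
      simp [h0] at hd1
    have hb' := hb
    rw [vecMul_matH] at hb'
    have hcoset : U2H.mk h = U2H.mk (torus h.1.2 * lower (matH h 1 0) (Units.mk0 _ hd0)) := by
      obtain ⟨e1, e2⟩ := matH_torus_mul_lower h.1.2 (matH h 1 0) (Units.mk0 _ hd0)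
      refine U2H.mk_eq_mk e1.symm e2.symm ?_
      change h.1.2 = h.1.2 * 1
      rw [mul_one]
    have hfixφ : π (embed p D (lower (matH h 1 0) (Units.mk0 _ hd0))) φ = φ :=
      hρU _ _ (hb'.1.trans_lt hrρ) (hb'.2.trans_lt hrρ)
    have hrow : Matrix.vecMul ![0, 1]
        (matH (torus h.1.2 * lower (matH h 1 0) (Units.mk0 _ hd0))) ∈ box p r := by
      obtain ⟨e1, e2⟩ := matH_torus_mul_lower h.1.2 (matH h 1 0) (Units.mk0 _ hd0)
      rw [vecMul_matH, e1, e2]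
      exact hb'
    rw [hcoset, integrand_mk, boxFun, Set.indicator_of_mem hrow, detH_torus_mul_lower, map_mul,
      map_mul, Module.End.mul_apply, hfixφ, hφ]
    by_cases hc : ψ (2 * e * (h.1.2 : Ep p D).im) = 1 ∧
      ψ (2 * e * ((h.1.2 : Ep p D).re - 1)) = 1
    · rw [if_pos hc.1, if_pos hc.2, if_pos ⟨hb, hc⟩]
      obtain ⟨u1, u2, u3⟩ := hηU h.1.2 (hsmall _ hc.2) (hsmall _ hc.1)
      rw [u1, u2, u3]
      simp
    · rw [if_neg (fun hh : P h => hc hh.2)]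
      rcases not_and_or.1 hc with hc | hc <;> simp [hc]
  -- Taking the nonvanishing locus of the integrand at s = 0 as the set makes openness a matter of
  -- continuity; by `key` it serves every s.
  refine ⟨φ, r, {x | integrand ν₁ (boxFun p r) hΛ φ 0 x ≠ 0}, Λ φ₀, hr, hr1, ?_,
    ⟨U2H.mk 1, ?_⟩, hφ₀, fun s => ?_⟩
  · rw [← U2H.isQuotientMap_mk.isOpen_preimage]
    exact isOpen_ne.preimage (continuous_integrandH_zero hν₁ hπ hr φ)
  · have h1 : P 1 := by
      refine ⟨?_, ?_, ?_⟩
      · rw [matH_one, Matrix.vecMul_one]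
        simp [box, hr.le]
      · change ψ (2 * e * (1 : Ep p D).im) = 1
        simp [QuadraticAlgebra.im_one]
      · change ψ (2 * e * ((1 : Ep p D).re - 1)) = 1
        simp [QuadraticAlgebra.re_one]
    change integrand ν₁ (boxFun p r) hΛ φ 0 (U2H.mk 1) ≠ 0
    rw [key, if_pos h1]
    exact hφ₀
  · funext x
    obtain ⟨h, rfl⟩ := U2H.mk_surjective x
    rw [Set.indicator_apply]
    change _ = if integrand ν₁ (boxFun p r) hΛ φ 0 (U2H.mk h) ≠ 0 then _ else _
    rw [key, key]
    by_cases hh : P h <;> simp [hh, hφ₀]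

/-- If the integrand is a nonzero multiple of the characteristic function of a nonempty open set,
then the value of the integral is nonzero at every point. -/
theorem LocalIntegralHasValue.ne_zero (hm : IsInvariantMeasure m)
    {hΛ : IsWhittakerFunctional ψ π Λ} {Φ : (Fin 2 → ℚ_[p]) → ℂ} {φ : V} {S : Set (U2H p D)}
    {c : ℂ} (hS : IsOpen S) (hne : S.Nonempty) (hc : c ≠ 0)
    (h : ∀ s, integrand ν₁ Φ hΛ φ s = S.indicator fun _ => c) {s₀ v : ℂ}
    (hv : LocalIntegralHasValue m ν₁ Φ hΛ φ s₀ v) : v ≠ 0 := by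
  obtain ⟨σ, hi, -⟩ := id hv
  -- Absolute convergence at a single s already forces the set to have finite measure.
  have h1 := hi ((σ + 1 : ℝ) : ℂ) (by simp)
  rw [h, integrable_indicator_iff hS.measurableSet, integrableOn_const_iff (by simp)] at h1
  have hfin : m S < ⊤ := by simpa [hc] using h1
  have hint : ∀ s, localIntegral m ν₁ Φ hΛ φ s = m.real S * c := by
    intro s
    rw [localIntegral, h, integral_indicator_const _ hS.measurableSet, Complex.real_smul]
  have hconst : LocalIntegralHasValue m ν₁ Φ hΛ φ s₀ (m.real S * c) :=
    ⟨σ, hi, fun _ => m.real S * c, fun x => MeromorphicAt.const _ x, fun s _ => (hint s).symm,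
      analyticAt_const, rfl⟩
  rw [hv.unique hconst]
  refine mul_ne_zero ?_ hc
  rw [Complex.ofReal_ne_zero, measureReal_def, ENNReal.toReal_ne_zero]
  exact ⟨hm.measure_ne_zero hS hne, hfin.ne⟩

end TestData

/-! ### Finiteness at s = 1 for the test function, by way of the centre. -/

section Extension

variable {p : ℕ} [Fact p.Prime] {D : ℕ} {V : Type*} [AddCommGroup V] [Module ℂ V]
  {ν₁ : ℚ_[p]ˣ →* ℂˣ} {ψ : AddChar ℚ_[p] Circle} {π : Representation ℂ (G p D) V}
  {Λ : V →ₗ[ℂ] ℂ} {hΛ : IsWhittakerFunctional ψ π Λ} {m : Measure (U2H p D)}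

theorem vecMul_translate_unip (u g : H p D) (hu : u ∈ U2 p D) :
    Matrix.vecMul ![0, 1] (matH (u * g)) = Matrix.vecMul ![0, 1] (matH g) := by
  have h : Matrix.vecMul ![0, 1] (matH u) = ![0, 1] := by
    rw [vecMul_matH]
    change ![u.1.1 1 0, u.1.1 1 1] = _
    rw [hu.2.2.1, hu.2.2.2]
  rw [matH_mul, ← Matrix.vecMul_vecMul, h]

/-- The bottom row of a coset in `U₂ \ H`. -/
noncomputable def U2H.row : U2H p D → Fin 2 → ℚ_[p] :=
  Quotient.lift (fun g => Matrix.vecMul ![0, 1] (matH g)) (by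
    intro x y hxy
    have hxy' : QuotientGroup.rightRel (U2 p D) x y := hxy
    rw [QuotientGroup.rightRel_apply] at hxy'
    have := vecMul_translate_unip _ x hxy'
    rw [inv_mul_cancel_right] at this
    exact this.symm)

theorem U2H.continuous_row : Continuous (U2H.row : U2H p D → Fin 2 → ℚ_[p]) := by
  rw [U2H.isQuotientMap_mk.continuous_iff]
  exact continuous_const.matrix_vecMul (Units.continuous_val.comp continuous_fst_H)

theorem matH_centerZ (t : ℚ_[p]ˣ) : matH (centerZ p D t) = Matrix.scalar (Fin 2) (t : ℚ_[p]) := rfl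

theorem detH_centerZ (t : ℚ_[p]ˣ) : detH (centerZ p D t) = t ^ 2 := by
  refine Units.ext ?_
  rw [← det_matH, matH_centerZ]
  simp [pow_two]

/-- The uniformizer `p` as a unit of `ℚ_p`. -/
noncomputable def primeUnit (p : ℕ) [hp : Fact p.Prime] : ℚ_[p]ˣ :=
  Units.mk0 (p : ℚ_[p]) (by exact_mod_cast hp.out.ne_zero)

/-- If the integral has value `0` at `s = 1` for all `Φ` with `Φ̂(0) = 0`, then it is finite at
`s = 1` for the characteristic function of a box around `(0, 1)`. -/
theorem exists_hasValue_boxFun (hm : IsInvariantMeasure m) {ω : ℚ_[p]ˣ →* ℂˣ}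
    (hω : ∀ (t : ℚ_[p]ˣ) (v : V), π (embed p D (centerZ p D t)) v = (ω t : ℂ) • v)
    (hνω : ν₁ ^ 2 * ω = 1)
    (hI : ∀ (φ : V) (Φ : (Fin 2 → ℚ_[p]) → ℂ), IsSchwartzBruhat Φ → fourier ψ Φ 0 = 0 →
      LocalIntegralHasValue m ν₁ Φ hΛ φ 1 0)
    {r : ℝ} (hr : 0 < r) (hr1 : r < 1) (φ : V) :
    ∃ c, LocalIntegralHasValue m ν₁ (boxFun p r) hΛ φ 1 c := by
  set h : H p D := centerZ p D (primeUnit p) with hh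
  set Φ := boxFun p r with hΦ
  have hS := isSchwartzBruhat_boxFun (p := p) hr
  set Φ' : (Fin 2 → ℚ_[p]) → ℂ := fun v => Φ (Matrix.vecMul v (matH h⁻¹)) with hΦ'
  set b : ℝ := ‖(detH h : ℚ_[p])‖ with hb
  have hpn : ‖((primeUnit p : ℚ_[p]ˣ) : ℚ_[p])‖ = (p : ℝ)⁻¹ := Padic.norm_p
  have hp1 : (p : ℝ)⁻¹ < 1 := inv_lt_one_of_one_lt₀ (by exact_mod_cast (Fact.out : p.Prime).one_lt)
  have hp0 : 0 < (p : ℝ)⁻¹ := by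
    have := (Fact.out : p.Prime).pos
    positivity
  have hbp : b = (p : ℝ)⁻¹ ^ 2 := by rw [hb, hh, detH_centerZ, Units.val_pow_eq_pow_val, norm_pow, hpn]
  have hb0 : 0 < b := by rw [hbp]; positivity
  have hb1 : b < 1 := by rw [hbp]; exact pow_lt_one₀ hp0.le hp1 two_ne_zero
  have hbC : (b : ℂ) ≠ 0 := by exact_mod_cast hb0.ne'
  obtain ⟨σ, hi, F, hF, hFI, hFa, hF0⟩ := hI φ _ ((hS.translate h).add (hS.const_mul (-(b : ℂ))))
    (fourier_translate_sub ψ hS h)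
  -- the two terms have disjoint supports
  have hdisj : ∀ v, v ∈ box p r → Φ' v = 0 := by
    intro v hv
    refine Set.indicator_of_notMem (fun hv' => ?_) _
    have h1 := norm_eq_one_of_mem_box hr1 hv
    have h2 := norm_eq_one_of_mem_box hr1 hv'
    have h3 : v = Matrix.vecMul (Matrix.vecMul v (matH h⁻¹)) (matH h) := by
      rw [Matrix.vecMul_vecMul, ← matH_mul, inv_mul_cancel, matH_one, Matrix.vecMul_one]
    have h4 : v 1 = Matrix.vecMul v (matH h⁻¹) 1 * (primeUnit p : ℚ_[p]) := by
      conv_lhs => rw [h3]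
      rw [hh, matH_centerZ, Matrix.scalar_apply, Matrix.vecMul_diagonal]
    rw [h4, norm_mul, h2, hpn, one_mul] at h1
    exact hp1.ne h1
  have hT : MeasurableSet (U2H.row ⁻¹' box p r : Set (U2H p D)) :=
    ((isClopen_box hr).isOpen.preimage U2H.continuous_row).measurableSet
  -- On cosets with bottom row in the box only the term -bΦ survives, so restricting there and
  -- dividing by -b recovers the integrand for Φ.
  have hint : ∀ s : ℂ, σ < s.re → Integrable (integrand ν₁ Φ hΛ φ s) m := by
    intro s hs
    refine (((hi s hs).indicator hT).const_mul (-(b : ℂ)⁻¹)).congr (ae_of_all _ fun x => ?_)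
    obtain ⟨g, rfl⟩ := U2H.mk_surjective x
    by_cases hg : Matrix.vecMul ![0, 1] (matH g) ∈ box p r
    · beta_reduce
      rw [Set.indicator_of_mem (show U2H.mk g ∈ U2H.row ⁻¹' box p r from hg), integrand_mk,
        integrand_mk]
      have h1 := hdisj _ hg
      rw [hΦ', hΦ] at h1
      beta_reduce at h1 ⊢
      rw [h1, hΦ]
      field_simp
      ring
    · beta_reduce
      rw [Set.indicator_of_notMem (show U2H.mk g ∉ U2H.row ⁻¹' box p r from hg), integrand_mk, hΦ,
        boxFun, Set.indicator_of_notMem hg]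
      simp
  -- Here h is central with determinant p², so it acts on φ by ω(p), which cancels ν₁(p²). Only the
  -- factor bˢ remains.
  have hrel : ∀ s x, integrand ν₁ Φ' hΛ φ s (U2H.translate h x) =
      (b : ℂ) ^ s * integrand ν₁ Φ hΛ φ s x := by
    intro s x
    have h1 := integrand_translate (ν₁ := ν₁) (hΛ := hΛ) Φ h φ s x
    rw [hh, hω, integrand_smul, ← hh, ← hb] at h1
    have h2 : (ν₁ (detH h) : ℂ) * (ω (primeUnit p) : ℂ) = 1 := by
      have := congrArg (fun χ : ℚ_[p]ˣ →* ℂˣ => (χ (primeUnit p) : ℂ)) hνω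
      rw [hh, detH_centerZ, map_pow]
      simpa using this
    have h3 : (b : ℂ) ^ s ≠ 0 := by simp [Complex.cpow_eq_zero_iff, hbC]
    have h4 : (ν₁ (detH h) : ℂ) ≠ 0 := Units.ne_zero _
    rw [Complex.cpow_neg] at h1
    have h5 : integrand ν₁ Φ' hΛ φ s (U2H.translate h x) = (ν₁ (detH h) : ℂ) * (b : ℂ) ^ s *
        ((ω (primeUnit p) : ℂ) * integrand ν₁ Φ hΛ φ s x) := by
      rw [h1]
      field_simp
      rfl
    rw [h5]
    linear_combination (b : ℂ) ^ s * integrand ν₁ Φ hΛ φ s x * h2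
  have hFI' : ∀ s : ℂ, σ < s.re → F s = ((b : ℂ) ^ s - b) * localIntegral m ν₁ Φ hΛ φ s := by
    intro s hs
    have hint' : Integrable (integrand ν₁ Φ' hΛ φ s) m := by
      rw [← (hm.measurePreserving h).integrable_comp_emb (U2H.measurableEmbedding_translate h)]
      exact ((hint s hs).const_mul ((b : ℂ) ^ s)).congr (ae_of_all _ fun x => (hrel s x).symm)
    rw [hFI s hs]
    simp only [localIntegral, integrand_add_left, integrand_const_mul]
    rw [integral_add hint' ((hint s hs).const_mul _), integral_const_mul,
      ← (hm.measurePreserving h).integral_comp (U2H.measurableEmbedding_translate h)]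
    simp only [hrel]
    rw [integral_const_mul]
    ring
  have hGd : ∀ s : ℂ, HasDerivAt (fun s : ℂ => (b : ℂ) ^ s - b) ((b : ℂ) ^ s * Complex.log b) s := by
    intro s
    simpa using ((hasDerivAt_id s).const_cpow (Or.inl hbC)).sub_const (b : ℂ)
  have hGdiff : Differentiable ℂ fun s : ℂ => (b : ℂ) ^ s - b := fun s => (hGd s).differentiableAt
  -- The zero of bˢ - b at s = 1 is simple: the derivative there is b log b, nonzero because 0 < b <
  -- 1.
  obtain ⟨Q, hQ, hQa, hQeq⟩ := exists_meromorphic_div hF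
    (fun x => (hGdiff.analyticAt x).meromorphicAt) hFa (hGdiff.analyticAt 1) hF0 (by simp) (by
      rw [(hGd 1).deriv, Complex.cpow_one]
      refine mul_ne_zero hbC ?_
      rw [← Complex.ofReal_log hb0.le, Complex.ofReal_ne_zero]
      exact (Real.log_neg hb0 hb1).ne)
  -- The bound 1 keeps s away from all zeros of bˢ - b: for Re s > 1 one has |bˢ| < b.
  refine ⟨Q 1, max σ 1, fun s hs => hint s ((le_max_left _ _).trans_lt hs), Q, hQ, fun s hs => ?_,
    hQa, rfl⟩
  have hs1 : 1 < s.re := (le_max_right _ _).trans_lt hs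
  have hne : s ≠ 1 := by rintro rfl; simp at hs1
  have hG0 : (b : ℂ) ^ s - b ≠ 0 := by
    intro h0
    have h1 := congrArg norm (sub_eq_zero.1 h0)
    rw [Complex.norm_cpow_eq_rpow_re_of_pos hb0, Complex.norm_real, Real.norm_of_nonneg hb0.le] at h1
    have h2 := Real.rpow_lt_rpow_of_exponent_gt hb0 hb1 hs1
    rw [Real.rpow_one] at h2
    exact h2.ne h1
  rw [hQeq s hne, hFI' s ((le_max_left _ _).trans_lt hs), mul_div_cancel_left₀ _ hG0]

end Extension

end PicardLocal

/-! ### The theorem. -/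

open PicardLocal in
theorem mainTheorem11 (p : ℕ) [Fact p.Prime] (D : ℕ)
    (hD : IsFundamentalDiscriminant (-(D : ℤ)))
    (ψ : AddChar ℚ_[p] Circle) (hψ : Continuous ψ) (hψ1 : ψ ≠ 1)
    {V : Type*} [AddCommGroup V] [Module ℂ V] (π : Representation ℂ (G p D) V)
    (hπ : IsSmooth π) (Λ : V →ₗ[ℂ] ℂ) (hΛ : IsWhittakerFunctional ψ π Λ)
    (ω : ℚ_[p]ˣ →* ℂˣ) (hω : ∀ (t : ℚ_[p]ˣ) (v : V), π (embed p D (centerZ p D t)) v = (ω t : ℂ) • v)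
    (ν₁ : ℚ_[p]ˣ →* ℂˣ) (hν₁ : Continuous ν₁) (hνω : ν₁ ^ 2 * ω = 1)
    (m : MeasureTheory.Measure (U2H p D)) (hm : IsInvariantMeasure m) :
    ((∀ (φ : V) (Φ : (Fin 2 → ℚ_[p]) → ℂ), IsSchwartzBruhat Φ → Φ 0 = 0 →
        LocalIntegralHasValue m ν₁ Φ hΛ φ 0 0) →
      IsDistinguished π (viaSimilitude D ν₁)⁻¹) ∧
    ((∀ (φ : V) (Φ : (Fin 2 → ℚ_[p]) → ℂ), IsSchwartzBruhat Φ → fourier ψ Φ 0 = 0 →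
        LocalIntegralHasValue m ν₁ Φ hΛ φ 1 0) →
      IsDistinguished π (viaSimilitude D ν₁)⁻¹) := by
  have hD0 : D ≠ 0 := by
    rintro rfl
    rcases hD with ⟨h, -⟩ | ⟨k, h, h', -⟩ <;> omega
  obtain ⟨φ₁, r, S, c₁, hr, hr1, hS, hne, hc₁, htest⟩ :=
    exists_test_data hD0 hψ hψ1 hπ hΛ hω hν₁ hνω
  refine ⟨fun hI => ?_, fun hI => ?_⟩
  · -- the test function vanishes at `0`, so the vanishing hypothesis fails for every such `π`
    exact absurd rfl ((hI φ₁ _ (isSchwartzBruhat_boxFun hr) (boxFun_zero hr1)).ne_zero hm hS hne hc₁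
      htest)
  · choose ℓ hℓ using exists_hasValue_boxFun hm hω hνω hI hr hr1
    refine ⟨{ toFun := ℓ, map_add' := fun φ φ' => ?_, map_smul' := fun a φ => ?_ }, fun h0 => ?_,
      fun h φ => ?_⟩
    · exact (hℓ (φ + φ')).unique ((hℓ φ).of_add (hℓ φ') fun s x => integrand_add_right _ φ φ' s x)
    · exact (hℓ (a • φ)).unique ((hℓ φ).smul hm a)
    · exact (hℓ φ₁).ne_zero hm hS hne hc₁ htest (LinearMap.congr_fun h0 φ₁)
    · have hSB := isSchwartzBruhat_boxFun (p := p) hr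
      have h1 := hI φ _ ((hSB.translate h).add (hSB.const_mul (-(‖(detH h : ℚ_[p])‖ : ℂ))))
        (fourier_translate_sub ψ hSB h)
      -- Φ₀(· h⁻¹) is a function of integral 0 plus |det h| Φ₀, so its value is 0 + |det h| ℓ(φ).
      -- Translating by h then multiplies by ν₁(det h)⁻¹|det h|⁻¹, and at s = 1 the absolute values
      -- cancel.
      have h2 := (h1.of_add ((hℓ φ).const_mul hm (‖(detH h : ℚ_[p])‖ : ℂ))
        (Φ := fun v => boxFun p r (Matrix.vecMul v (matH h⁻¹))) (φ := φ) fun s x => by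
          rw [← integrand_add_left]
          congr 1
          funext v
          ring).translate hm h
      have h3 := (hℓ (π (embed p D h) φ)).unique h2
      have hb0 : (‖(detH h : ℚ_[p])‖ : ℂ) ≠ 0 := by
        exact_mod_cast (norm_pos_iff.2 (detH h).ne_zero).ne'
      change ℓ (π (embed p D h) φ) = _ * ℓ φ
      rw [h3, zero_add, MonoidHom.inv_apply, viaSimilitude_apply, Units.val_inv_eq_inv_val,
        Complex.cpow_neg, Complex.cpow_one]
      field_simp
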